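/- **Theorem (Acoustic case).** Consider the two-layer thin film system $\mathbf U_t+\mathbf F(\mathbf U)_x=0$ for $\mathbf U=(f,b,g,q)^\top$ with flux $$\mathbf F(\mathbf U)=\Big(\tfrac12 f^2b,\ \tfrac12 fb^2,\ \tfrac12 g^2q+fbg,\ \tfrac12 gq^2+fbq\Big)^\top$$ in the state space $\mathcal U=\{f,g,q>0,\ b<0,\ fb+gq\ge 0\}$. Put $u=fb$, $v=gq$, $\xi=f/b$, $\tau=g/q$; the characteristic speeds are $\lambda_1=\frac32u$, $\lambda_2=\frac12u$, $\lambda_3=u+\frac12v$, $\lambda_4=u+\frac32v$. Let $\mathbf U_0\in\mathcal U$, and let $\mathbf P_L$ on $(-\infty,0]$ and $\mathbf P_R$ on $[0,\infty)$ be $C^1$ with $\mathbf P_L(0)=\mathbf P_R(0)=\mathbf U_0$ and one-sided slopes $\mathbf U_L'=\mathbf P_L'(0^-)\ne\mathbf U_R'=\mathbf P_R'(0^+)$ (for instance $\mathbf P_{L}(x)=\mathbf U_0+\mathbf U_{L}'x$ and $\mathbf P_{R}(x)=\mathbf U_0+\mathbf U_{R}'x$). Let $\mathbf U$ be, on $(-\delta,\delta)\times(0,T)$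 for some $\delta,T>0$, a piecewise smooth entropy solution with values in $\mathcal U$ and initial data $\mathbf P_L$ for $x<0$, $\mathbf P_R$ for $x>0$, of the following form. There are four $C^1$ fronts $x=X_k(t)$, $0\le t<T$, $k=1,\dots,4$, that stay in $(-\delta,\delta)$, with $X_k(0)=0$ and $X_1<X_2<X_3<X_4$ for $t>0$. In each of the five open regions that they bound, $\mathbf U$ is $C^1$ and satisfies the system, and $\mathbf U$ (with value in $\mathcal U$), $\mathbf U_x$, $\mathbf U_t$ have limits at the origin. For $t>0$, $\mathbf U$ has one-sided limits $\mathbf U_l,\mathbf U_r\in\mathcal U$ at the fronts. For $k=1,4$ these satisfy the Rankine–Hugoniot conditions $X_k'(\mathbf U_r-\mathbf U_l)=\mathbf F(\mathbf U_r)-\mathbf F(\mathbf U_l)$ and the Lax condition $\lambda_k(\mathbf U_r)\le X_k'\le\lambda_k(\mathbf U_l)$ (zero jumps being allowed). The second front is a contact wave: $X_2'=u/2$, and $u,g,q$ are continuous across it. The third front is a contact wave: $X_3'=u+v/2$, and $f,b,v$ are continuous across it. Let the subscripts $^*_L$ and $^*_R$ denote limits at the origin taken in the region between the fronts 1 and 2,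 and between the fronts 3 and 4, respectively. Then the six instantaneous time derivatives $$\frac{\partial\mathbf U^*}{\partial t}=\Big[\big(\tfrac{\partial f}{\partial t}\big)^*_L,\big(\tfrac{\partial b}{\partial t}\big)^*_L,\big(\tfrac{\partial g}{\partial t}\big)^*_L,\big(\tfrac{\partial q}{\partial t}\big)^*_L,\big(\tfrac{\partial g}{\partial t}\big)^*_R,\big(\tfrac{\partial q}{\partial t}\big)^*_R\Big]^\top$$ are the unique solution of the linear system $\mathbf A(\mathbf U_0)\,\dfrac{\partial\mathbf U^*}{\partial t}=\mathbf D(\mathbf U_0,\mathbf U_L',\mathbf U_R')$, where the matrix $$\mathbf A(\mathbf U_0)=\begin{bmatrix} b_0&f_0&0&0&0&0\\ \frac1{b_0}&-\frac{f_0}{b_0^2}&0&0&0&0\\ 0&0&q_0&g_0&0&0\\ 0&0&\frac1{q_0}&-\frac{g_0}{q_0^2}&0&0\\ 0&0&-q_0&-g_0&q_0&g_0\\ 0&0&0&0&\frac1{q_0}&-\frac{g_0}{q_0^2}\end{bmatrix}$$ is invertible and $$\mathbf D(\mathbf U_0,\mathbf U_L',\mathbf U_R')=\begin{bmatrix}-\frac32u_0u_R'\\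 -\frac12u_0\xi_L'\\ \frac{4v_0}{3v_0-u_0}\Big(\frac32u_0u_R'-(u_0+\frac32v_0)\big(u_L'+v_L'(\frac34-\frac{u_0}{4v_0})\big)\Big)\\ -\frac12(2u_0+v_0)\tau_L'\\ 0\\ -\frac12(2u_0+v_0)\tau_R'\end{bmatrix}.$$ Here $u_0=f_0b_0$, $v_0=g_0q_0$, and for either side $u'=b_0f'+f_0b'$, $v'=q_0g'+g_0q'$, $\xi'=\frac{f'}{b_0}-\frac{f_0}{b_0^2}b'$, $\tau'=\frac{g'}{q_0}-\frac{g_0}{q_0^2}q'$. -/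

import Mathlib

open Set Filter Topology

namespace ThinFilm

/-- A vector `(f, b, g, q)` of conservative variables (or of slopes of these). -/
abbrev State := Fin 4 → ℝ

/-- The state space: `f, g, q > 0`, `b < 0`, `f b + g q ≥ 0`. -/
def stateSpace : Set State :=
  {U | 0 < U 0 ∧ U 1 < 0 ∧ 0 < U 2 ∧ 0 < U 3 ∧ 0 ≤ U 0 * U 1 + U 2 * U 3}

/-- The flux of the two-layer thin film system. -/
noncomputable def flux (U : State) : State :=
  ![U 0 ^ 2 * U 1 / 2,
    U 0 * U 1 ^ 2 / 2,
    U 2 ^ 2 * U 3 / 2 + U 0 * U 1 * U 2,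
    U 2 * U 3 ^ 2 / 2 + U 0 * U 1 * U 3]

/-- `u = f b`. -/
def u (U : State) : ℝ := U 0 * U 1

/-- `v = g q`. -/
def v (U : State) : ℝ := U 2 * U 3

/-- The slope `u'` of `u = f b` at the state `U` for the slope `U'` of the conservative
variables. -/
def uSlope (U U' : State) : ℝ := U 1 * U' 0 + U 0 * U' 1

/-- The slope `v'` of `v = g q`. -/
def vSlope (U U' : State) : ℝ := U 3 * U' 2 + U 2 * U' 3

/-- The slope `ξ'` of `ξ = f / b`. -/
noncomputable def xiSlope (U U' : State) : ℝ := U' 0 / U 1 - U 0 / U 1 ^ 2 * U' 1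

/-- The slope `τ'` of `τ = g / q`. -/
noncomputable def tauSlope (U U' : State) : ℝ := U' 2 / U 3 - U 2 / U 3 ^ 2 * U' 3

/-- The first (genuinely nonlinear) characteristic speed. -/
noncomputable def lambda1 (U : State) : ℝ := 3 / 2 * u U

/-- The fourth (genuinely nonlinear) characteristic speed. -/
noncomputable def lambda4 (U : State) : ℝ := u U + 3 / 2 * v U

/-- The Rankine-Hugoniot conditions for a front of speed `σ` between `Ul` and `Ur`. -/
def RankineHugoniot (σ : ℝ) (Ul Ur : State) : Prop :=
  σ • (Ur - Ul) = flux Ur - flux Ul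

/-- Admissible front of the `k`-th family (`k = 1, …, 4` is the index `0, …, 3`).
For the genuinely nonlinear families: Rankine-Hugoniot and the Lax entropy condition, with
non-strict inequalities so that a front of zero strength (a jump of the first derivatives only)
that moves at characteristic speed is included.
For the linearly degenerate families: the contact waves. -/
def IsWave : Fin 4 → ℝ → State → State → Prop
  | 0, σ, Ul, Ur => RankineHugoniot σ Ul Ur ∧ lambda1 Ur ≤ σ ∧ σ ≤ lambda1 Ul
  | 1, σ, Ul, Ur => σ = u Ul / 2 ∧ u Ur = u Ul ∧ Ur 2 = Ul 2 ∧ Ur 3 = Ul 3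
  | 2, σ, Ul, Ur => σ = u Ul + v Ul / 2 ∧ Ur 0 = Ul 0 ∧ Ur 1 = Ul 1 ∧ v Ur = v Ul
  | 3, σ, Ul, Ur => RankineHugoniot σ Ul Ur ∧ lambda4 Ur ≤ σ ∧ σ ≤ lambda4 Ul

/-- The open region of `(-δ, δ) × (0, T)` (points are `(x, t)`) that lies to the right of the
first `j` of the four fronts `x = X i t` and to the left of the others. -/
def sector (δ T : ℝ) (X : Fin 4 → ℝ → ℝ) (j : Fin 5) : Set (ℝ × ℝ) :=
  {p | p.2 ∈ Ioo 0 T ∧ p.1 ∈ Ioo (-δ) δ ∧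
    ∀ i : Fin 4, (i.castSucc < j → X i p.2 < p.1) ∧ (j ≤ i.castSucc → p.1 < X i p.2)}

/-- `U` is, near the origin, a piecewise smooth entropy solution of `U_t + F(U)_x = 0` with initial
data `PL` for `x < 0` and `PR` for `x > 0`, whose wave pattern consists of four fronts `x = X i t`,
one of each family, that emanate from the origin. -/
structure IsGRPSolution (PL PR : ℝ → State) (δ T : ℝ) (X : Fin 4 → ℝ → ℝ)
    (U : ℝ × ℝ → State) : Prop where
  δ_pos : 0 < δ
  T_pos : 0 < T
  front_contDiff : ∀ i, ContDiffOn ℝ 1 (X i) (Ico 0 T)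
  front_zero : ∀ i, X i 0 = 0
  front_mem : ∀ i, ∀ t ∈ Ico 0 T, X i t ∈ Ioo (-δ) δ
  front_strictMono : ∀ t ∈ Ioo 0 T, StrictMono fun i => X i t
  mem_stateSpace : ∀ j, ∀ p ∈ sector δ T X j, U p ∈ stateSpace
  contDiff : ∀ j, ContDiffOn ℝ 1 U (sector δ T X j)
  /-- The conservation law holds in each region. -/
  pde : ∀ j, ∀ p ∈ sector δ T X j,
    fderiv ℝ U p (0, 1) + fderiv ℝ (fun r => flux (U r)) p (1, 0) = 0
  /-- The initial data are attained. -/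
  initial_left : ∀ x ∈ Ioo (-δ) 0, Tendsto U (𝓝[sector δ T X 0] (x, 0)) (𝓝 (PL x))
  initial_right : ∀ x ∈ Ioo 0 δ, Tendsto U (𝓝[sector δ T X 4] (x, 0)) (𝓝 (PR x))
  /-- The one-sided traces along each front form an admissible wave of its family. -/
  wave : ∀ i, ∀ t ∈ Ioo 0 T, ∃ Ul ∈ stateSpace, ∃ Ur ∈ stateSpace,
    Tendsto U (𝓝[sector δ T X i.castSucc] (X i t, t)) (𝓝 Ul) ∧
    Tendsto U (𝓝[sector δ T X i.succ] (X i t, t)) (𝓝 Ur) ∧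
    IsWave i (deriv (X i) t) Ul Ur
  /-- In each region `U` has a trace at the origin, not assumed to be the same in all regions. -/
  trace : ∀ j, ∃ W ∈ stateSpace, Tendsto U (𝓝[sector δ T X j] (0, 0)) (𝓝 W)
  /-- In each region the first derivatives of `U` have a trace at the origin. -/
  trace_fderiv : ∀ j, ∃ L, Tendsto (fderiv ℝ U) (𝓝[sector δ T X j] (0, 0)) (𝓝 L)

/-- `V` is the instantaneous time derivative `lim ∂U/∂t` at the origin, taken from within `s`. -/
def IsInstantaneousTimeDeriv (U : ℝ × ℝ → State) (s : Set (ℝ × ℝ)) (V : State) : Prop :=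
  Tendsto (fun p => fderiv ℝ U p (0, 1)) (𝓝[s] (0, 0)) (𝓝 V)

/-- The coefficient matrix `A(U₀)`. -/
noncomputable def acousticMatrix (U : State) : Matrix (Fin 6) (Fin 6) ℝ :=
  !![U 1,     U 0,              0,       0,                0,       0;
     1 / U 1, -(U 0 / U 1 ^ 2), 0,       0,                0,       0;
     0,       0,                U 3,     U 2,              0,       0;
     0,       0,                1 / U 3, -(U 2 / U 3 ^ 2), 0,       0;
     0,       0,                -U 3,    -U 2,             U 3,     U 2;
     0,       0,                0,       0,                1 / U 3, -(U 2 / U 3 ^ 2)]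

/-- The right-hand side `D(U₀, U_L', U_R')`. -/
noncomputable def acousticRHS (U UL' UR' : State) : Fin 6 → ℝ :=
  ![-(3 / 2) * u U * uSlope U UR',
    -(1 / 2) * u U * xiSlope U UL',
    4 * v U / (3 * v U - u U) *
      (3 / 2 * u U * uSlope U UR' -
        (u U + 3 / 2 * v U) *
          (uSlope U UL' + vSlope U UL' * (3 / 4 - u U / (4 * v U)))),
    -(1 / 2) * (2 * u U + v U) * tauSlope U UL',
    0,
    -(1 / 2) * (2 * u U + v U) * tauSlope U UR']

end ThinFilm

/-! In each of the five regions, the limits of `U` and of its derivative give a first-order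
expansion at the origin that stays valid on the bounding fronts (`isLittleO_of_tendsto_fderiv`,
`hasFDerivWithinAt_extendFrom`). The regions need not be convex, so this rests on paths to the
origin of length comparable to the distance (`hasPaths_sector`).

At order zero, the wave conditions are closed (the Lax inequalities are not strict) and survive the
limit t → 0. They form a Riemann problem with both outer states U₀, whose only solution is constant,
with characteristic front speeds (`riemann_const`).

At order one, let [P] be the jump of U_x across a front of speed σ. Since U_t = -F'(U₀) U_x, the
derivative along the front jumps by (σ - F'(U₀))[P]. The linearized Rankine–Hugoniot conditions give
(σ - F'(U₀))²[P] = 0 at fronts 1 and 4; at the contacts, the derivatives of u and v along the front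
do not jump. In the coordinates u', ξ', τ', v' the matrix F'(U₀) is triangular, and only the v' row
is coupled, to u'. Hence u' crosses fronts 2, 3, 4 unchanged, v' crosses 2 and 3, ξ' crosses 1, and
τ' crosses 1 and 4, while (3v₀ - u₀)[v'] + 4v₀[u'] = 0 at front 1. The required slopes are thus
known from the outer data, and the conservation law turns them into time derivatives
(`acoustic_of_traces`). Uniqueness is `isUnit_acousticMatrix`. -/

namespace ThinFilm

/-! ### First-order expansion at a boundary point. -/

section Trace

variable {E F : Type*} [NormedAddCommGroup E] [NormedSpace ℝ E]
  [NormedAddCommGroup F] [NormedSpace ℝ F]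

/-- If every point of `S` near `0` is joined to `0` inside `S` by a path whose length is comparable
to the norm of the point, then limits of `U` and of its derivative at `0` give a first order
expansion of `U` on `S`. -/
theorem isLittleO_of_tendsto_fderiv {S : Set E} {U : E → F} {W : F} {L : E →L[ℝ] F}
    (hd : ∀ p ∈ S, DifferentiableAt ℝ U p) (hW : Tendsto U (𝓝[S] 0) (𝓝 W))
    (hL : Tendsto (fderiv ℝ U) (𝓝[S] 0) (𝓝 L)) {C : ℝ} (hC : 0 < C)
    (hpath : ∀ᶠ p in 𝓝[S] 0, ∃ γ γ' : ℝ → E, ∃ t₀ > 0, γ t₀ = p ∧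
      Tendsto γ (𝓝[>] 0) (𝓝 0) ∧ ∀ t ∈ Ioc 0 t₀, γ t ∈ S ∧ ‖γ t‖ ≤ C * ‖p‖ ∧
        HasDerivAt γ (γ' t) t ∧ t₀ * ‖γ' t‖ ≤ C * ‖p‖) :
    (fun p => U p - W - L p) =o[𝓝[S] 0] fun p => p := by
  rw [Asymptotics.isLittleO_iff]
  intro c hc
  -- Along the path the error grows by at most ε times the length bound C‖p‖, so this ε yields c‖p‖.
  set ε := c / C with hε
  have hεpos : 0 < ε := div_pos hc hC
  have h1 : ∀ᶠ p in 𝓝[S] (0 : E), ‖fderiv ℝ U p - L‖ ≤ ε := by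
    have := hL.eventually (Metric.closedBall_mem_nhds L hεpos)
    filter_upwards [this] with p hp
    simpa [dist_eq_norm] using hp
  rw [eventually_nhdsWithin_iff, Metric.eventually_nhds_iff] at h1
  obtain ⟨η, hη, h1⟩ := h1
  have h2 : ∀ᶠ p in 𝓝[S] (0 : E), C * ‖p‖ < η := by
    have : Tendsto (fun p : E => C * ‖p‖) (𝓝[S] 0) (𝓝 (C * ‖(0 : E)‖)) :=
      ((continuous_const.mul continuous_norm).tendsto 0).mono_left nhdsWithin_le_nhds
    exact this.eventually (gt_mem_nhds (by simpa using hη))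
  filter_upwards [hpath, h2] with p ⟨γ, γ', t₀, ht₀, hγp, hγ0, hγ⟩ hpη
  have hder : ∀ t ∈ Ioc 0 t₀, HasDerivWithinAt (fun t => U (γ t) - L (γ t))
      ((fderiv ℝ U (γ t) - L) (γ' t)) (Ioc 0 t₀) t := by
    intro t ht
    obtain ⟨hS, -, hdγ, -⟩ := hγ t ht
    have hU := ((hd _ hS).hasFDerivAt.comp_hasDerivAt t hdγ)
    have hLγ := (L.hasFDerivAt.comp_hasDerivAt t hdγ)
    exact (hU.sub hLγ).hasDerivWithinAt
  have hbd : ∀ t ∈ Ioc 0 t₀, ‖(fderiv ℝ U (γ t) - L) (γ' t)‖ ≤ c * ‖p‖ / t₀ := by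
    intro t ht
    obtain ⟨hS, hn, -, hn'⟩ := hγ t ht
    have hb := h1 (y := γ t) (by simpa [dist_eq_norm] using hn.trans_lt hpη) hS
    have hb' : ‖γ' t‖ ≤ C * ‖p‖ / t₀ := by
      rw [le_div_iff₀ ht₀]; linarith
    calc ‖(fderiv ℝ U (γ t) - L) (γ' t)‖ ≤ ‖fderiv ℝ U (γ t) - L‖ * ‖γ' t‖ :=
          ContinuousLinearMap.le_opNorm _ _
      _ ≤ ε * (C * ‖p‖ / t₀) := by gcongr
      _ = c * ‖p‖ / t₀ := by rw [hε]; field_simp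
  -- The end point 0 need not lie in `S`, so the mean value inequality is used between γ s and p,
  -- and then s → 0.
  have hmvt : ∀ s ∈ Ioc 0 t₀, ‖(U p - L p) - (U (γ s) - L (γ s))‖ ≤ c * ‖p‖ := by
    intro s hs
    have := (convex_Ioc 0 t₀).norm_image_sub_le_of_norm_hasDerivWithin_le hder hbd hs
      (right_mem_Ioc.2 ht₀)
    rw [hγp] at this
    refine this.trans ?_
    rw [Real.norm_eq_abs, abs_of_nonneg (by linarith [hs.2]), div_mul_eq_mul_div,
      div_le_iff₀ ht₀]
    have : 0 ≤ c * ‖p‖ := by positivity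
    nlinarith [hs.1]
  have hmem : ∀ᶠ s in 𝓝[>] (0 : ℝ), s ∈ Ioc 0 t₀ := Ioc_mem_nhdsGT ht₀
  have hγS : Tendsto γ (𝓝[>] 0) (𝓝[S] 0) :=
    tendsto_nhdsWithin_iff.2 ⟨hγ0, hmem.mono fun s hs => (hγ s hs).1⟩
  have hlim : Tendsto (fun s => ‖(U p - L p) - (U (γ s) - L (γ s))‖) (𝓝[>] 0)
      (𝓝 ‖(U p - L p) - (W - L 0)‖) :=
    ((tendsto_const_nhds).sub ((hW.comp hγS).sub ((L.continuous.tendsto 0).comp hγ0))).norm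
  have := le_of_tendsto hlim (hmem.mono hmvt)
  rw [map_zero, sub_zero] at this
  rwa [sub_right_comm]

/-- A first order expansion on `S` passes to the extension of `U` by its limits at points of the
closure. -/
theorem hasFDerivWithinAt_extendFrom {S : Set E} {U : E → F} {W : F} {L : E →L[ℝ] F}
    (h0 : (0 : E) ∈ closure S) (hW : Tendsto U (𝓝[S] 0) (𝓝 W))
    (h : (fun p => U p - W - L p) =o[𝓝[S] 0] fun p => p) :
    HasFDerivWithinAt (extendFrom S U) L
      {p | p ∈ closure S ∧ ∃ y, Tendsto U (𝓝[S] p) (𝓝 y)} 0 := by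
  rw [hasFDerivWithinAt_iff_isLittleO, Asymptotics.isLittleO_iff]
  intro c hc
  have h1 := Asymptotics.isLittleO_iff.1 h hc
  rw [eventually_nhdsWithin_iff, Metric.eventually_nhds_iff] at h1
  obtain ⟨η, hη, h1⟩ := h1
  filter_upwards [self_mem_nhdsWithin, nhdsWithin_le_nhds (Metric.ball_mem_nhds 0 hη)]
    with p ⟨hpc, y, hy⟩ hp
  rw [extendFrom_eq h0 hW, extendFrom_eq hpc hy, sub_zero]
  have : (𝓝[S] p).NeBot := mem_closure_iff_nhdsWithin_neBot.1 hpc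
  have hid : Tendsto (fun q : E => q) (𝓝[S] p) (𝓝 p) := nhdsWithin_le_nhds
  -- The estimate is a non-strict inequality between limits, so it extends from q in `S` to p in the
  -- closure.
  refine le_of_tendsto_of_tendsto ((hy.sub_const W).sub ((L.continuous.tendsto p).comp hid)).norm
    (hid.norm.const_mul c) ?_
  filter_upwards [self_mem_nhdsWithin, nhdsWithin_le_nhds (Metric.isOpen_ball.mem_nhds hp)]
    with q hqS hq
  exact h1 hq hqS

end Trace

/-! ### One-sided derivatives at t = 0. -/

section OneSided

variable {F : Type*} [NormedAddCommGroup F] [NormedSpace ℝ F]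

theorem tendsto_slope_zero_of_hasDerivWithinAt {f : ℝ → F} {f' : F}
    (h : HasDerivWithinAt f f' (Ioi 0) 0) :
    Tendsto (fun t => t⁻¹ • (f t - f 0)) (𝓝[>] 0) (𝓝 f') := by
  have := (hasDerivWithinAt_iff_tendsto_slope' (by simp)).1 h
  refine this.congr fun t => ?_
  rw [slope_def_module, sub_zero]

theorem tendsto_zero_of_hasDerivWithinAt {f : ℝ → F} {f' : F}
    (h : HasDerivWithinAt f f' (Ioi 0) 0) : Tendsto f (𝓝[>] 0) (𝓝 (f 0)) :=
  h.continuousWithinAt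

/-- Agreement is needed only for t > 0; the values at 0 then agree by continuity. This
differentiates identities that hold along a front for positive times. -/
theorem hasDerivWithinAt_Ioi_unique {f g : ℝ → F} {f' g' : F}
    (hf : HasDerivWithinAt f f' (Ioi 0) 0) (hg : HasDerivWithinAt g g' (Ioi 0) 0)
    (h : ∀ᶠ t in 𝓝[>] 0, f t = g t) : f' = g' := by
  have h0 : f 0 = g 0 := tendsto_nhds_unique
    ((tendsto_zero_of_hasDerivWithinAt hf).congr' h) (tendsto_zero_of_hasDerivWithinAt hg)
  exact (uniqueDiffWithinAt_Ioi 0).eq_deriv _ hf (hg.congr_of_eventuallyEq h h0)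

/-- One-sided limit of the derivative of a `C¹` function at the left end point. -/
theorem ContDiffOn.exists_tendsto_deriv_Ico {f : ℝ → F} {T : ℝ} (hT : 0 < T)
    (hf : ContDiffOn ℝ 1 f (Ico 0 T)) :
    ∃ σ, Tendsto (deriv f) (𝓝[>] 0) (𝓝 σ) ∧ HasDerivWithinAt f σ (Ioi 0) 0 := by
  have h0 : (0 : ℝ) ∈ Ico 0 T := ⟨le_rfl, hT⟩
  refine ⟨derivWithin f (Ico 0 T) 0, ?_, ?_⟩
  · have hc := (hf.continuousOn_derivWithin (uniqueDiffOn_Ico 0 T) le_rfl) 0 h0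
    have hc' : Tendsto (derivWithin f (Ico 0 T)) (𝓝[>] 0) (𝓝 (derivWithin f (Ico 0 T) 0)) :=
      hc.tendsto.mono_left (by
        rw [← nhdsWithin_Ioo_eq_nhdsGT hT]; exact nhdsWithin_mono _ Ioo_subset_Ico_self)
    refine hc'.congr' ?_
    filter_upwards [Ioo_mem_nhdsGT hT] with t ht
    exact derivWithin_of_mem_nhds (Ico_mem_nhds ht.1 ht.2)
  · have := ((hf.differentiableOn one_ne_zero) 0 h0).hasDerivWithinAt
    exact (this.mono Ioo_subset_Ico_self).mono_of_mem_nhdsWithin (Ioo_mem_nhdsGT hT)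

end OneSided

/-! ### The flux Jacobian and its left eigenvectors. -/

theorem contDiff_flux : ContDiff ℝ 1 flux := by
  rw [contDiff_pi]
  intro i
  fin_cases i <;> simp [flux] <;> fun_prop

theorem fderiv_flux_apply (U V : State) : fderiv ℝ flux U V =
    ![U 0 * U 1 * V 0 + U 0 ^ 2 * V 1 / 2,
      U 1 ^ 2 * V 0 / 2 + U 0 * U 1 * V 1,
      U 2 * U 3 * V 2 + U 2 ^ 2 * V 3 / 2 + U 1 * U 2 * V 0 + U 0 * U 2 * V 1 + U 0 * U 1 * V 2,
      U 3 ^ 2 * V 2 / 2 + U 2 * U 3 * V 3 + U 1 * U 3 * V 0 + U 0 * U 3 * V 1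
        + U 0 * U 1 * V 3] := by
  -- The base point is written this way to match the line t ↦ U + tV at t = 0 in the chain rule.
  have hd : HasFDerivAt flux (fderiv ℝ flux U) (U + (0 : ℝ) • V) := by
    simpa using (contDiff_flux.differentiable one_ne_zero U).hasFDerivAt
  have hl : HasDerivAt (fun t : ℝ => U + t • V) V 0 := by
    simpa using ((hasDerivAt_id (0 : ℝ)).smul_const V).const_add U
  have hc := hasDerivAt_pi.1 (hd.comp_hasDerivAt 0 hl)
  have hi : ∀ i, HasDerivAt (fun t : ℝ => U i + t * V i) (V i) 0 := fun i => by
    simpa using hasDerivAt_pi.1 hl i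
  ext i
  refine (hc i).unique ?_
  fin_cases i
  · refine ((((hi 0).pow 2).mul (hi 1)).div_const 2).congr_deriv ?_
    simp; ring
  · refine (((hi 0).mul ((hi 1).pow 2)).div_const 2).congr_deriv ?_
    simp; ring
  · refine (((((hi 2).pow 2).mul (hi 3)).div_const 2).add
      (((hi 0).mul (hi 1)).mul (hi 2))).congr_deriv ?_
    simp; ring
  · refine ((((hi 2).mul ((hi 3).pow 2)).div_const 2).add
      (((hi 0).mul (hi 1)).mul (hi 3))).congr_deriv ?_
    simp; ring

section Slopes

variable (U V : State)

/-- The gradients of u, ξ and τ are left eigenvectors of the Jacobian, with eigenvalues λ₁, λ₂ and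
λ₃. The gradient of v has λ₄ on the diagonal and a coupling 2v to u', which is the only off-diagonal
term. -/
theorem uSlope_fderiv_flux : uSlope U (fderiv ℝ flux U V) = 3 / 2 * u U * uSlope U V := by
  rw [fderiv_flux_apply]; simp [uSlope, u]; ring

theorem vSlope_fderiv_flux : vSlope U (fderiv ℝ flux U V) =
    (u U + 3 / 2 * v U) * vSlope U V + 2 * v U * uSlope U V := by
  rw [fderiv_flux_apply]; simp [uSlope, vSlope, u, v]; ring

theorem xiSlope_fderiv_flux (h : U 1 ≠ 0) :
    xiSlope U (fderiv ℝ flux U V) = 1 / 2 * u U * xiSlope U V := by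
  rw [fderiv_flux_apply]; simp [xiSlope, u]; field_simp; ring

theorem tauSlope_fderiv_flux (h : U 3 ≠ 0) :
    tauSlope U (fderiv ℝ flux U V) = (u U + 1 / 2 * v U) * tauSlope U V := by
  rw [fderiv_flux_apply]; simp [tauSlope, u, v]; field_simp; ring

variable (V' : State) (c : ℝ)

theorem uSlope_add : uSlope U (V + V') = uSlope U V + uSlope U V' := by
  simp [uSlope]; ring
theorem vSlope_add : vSlope U (V + V') = vSlope U V + vSlope U V' := by
  simp [vSlope]; ring
theorem xiSlope_add : xiSlope U (V + V') = xiSlope U V + xiSlope U V' := by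
  simp [xiSlope]; ring
theorem tauSlope_add : tauSlope U (V + V') = tauSlope U V + tauSlope U V' := by
  simp [tauSlope]; ring
theorem uSlope_smul : uSlope U (c • V) = c * uSlope U V := by
  simp [uSlope]; ring
theorem vSlope_smul : vSlope U (c • V) = c * vSlope U V := by
  simp [vSlope]; ring
theorem xiSlope_smul : xiSlope U (c • V) = c * xiSlope U V := by
  simp [xiSlope]; ring
theorem tauSlope_smul : tauSlope U (c • V) = c * tauSlope U V := by
  simp [tauSlope]; ring
theorem uSlope_sub : uSlope U (V - V') = uSlope U V - uSlope U V' := by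
  simp [uSlope]; ring
theorem vSlope_sub : vSlope U (V - V') = vSlope U V - vSlope U V' := by
  simp [vSlope]; ring
theorem xiSlope_sub : xiSlope U (V - V') = xiSlope U V - xiSlope U V' := by
  simp [xiSlope]; ring
theorem tauSlope_sub : tauSlope U (V - V') = tauSlope U V - tauSlope U V' := by
  simp [tauSlope]; ring

end Slopes

/-! ### Closedness and linearization of the wave conditions. -/

theorem hasDerivWithinAt_u {w : ℝ → State} {w' : State} {s : Set ℝ} {t : ℝ}
    (h : HasDerivWithinAt w w' s t) :
    HasDerivWithinAt (fun r => u (w r)) (uSlope (w t) w') s t := by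
  have hi := hasDerivWithinAt_pi.1 h
  refine HasDerivWithinAt.congr_deriv ((hi 0).mul (hi 1)) ?_
  simp [uSlope]; ring

theorem hasDerivWithinAt_v {w : ℝ → State} {w' : State} {s : Set ℝ} {t : ℝ}
    (h : HasDerivWithinAt w w' s t) :
    HasDerivWithinAt (fun r => v (w r)) (vSlope (w t) w') s t := by
  have hi := hasDerivWithinAt_pi.1 h
  refine HasDerivWithinAt.congr_deriv ((hi 2).mul (hi 3)) ?_
  simp [vSlope]; ring

/-- The set of admissible waves is closed. -/
theorem isClosed_isWave (i : Fin 4) :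
    IsClosed {z : ℝ × State × State | IsWave i z.1 z.2.1 z.2.2} := by
  have hF : Continuous flux := contDiff_flux.continuous
  have hu : Continuous u := by unfold u; fun_prop
  have hv : Continuous v := by unfold v; fun_prop
  fin_cases i
  · refine IsClosed.and (isClosed_eq ?_ ?_) (IsClosed.and (isClosed_le ?_ ?_) (isClosed_le ?_ ?_))
    all_goals (try unfold lambda1); fun_prop
  · refine IsClosed.and (isClosed_eq ?_ ?_) (IsClosed.and (isClosed_eq ?_ ?_)
      (IsClosed.and (isClosed_eq ?_ ?_) (isClosed_eq ?_ ?_)))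
    all_goals fun_prop
  · refine IsClosed.and (isClosed_eq ?_ ?_) (IsClosed.and (isClosed_eq ?_ ?_)
      (IsClosed.and (isClosed_eq ?_ ?_) (isClosed_eq ?_ ?_)))
    all_goals fun_prop
  · refine IsClosed.and (isClosed_eq ?_ ?_) (IsClosed.and (isClosed_le ?_ ?_) (isClosed_le ?_ ?_))
    all_goals (try unfold lambda4); fun_prop

/-- The Rankine-Hugoniot conditions linearized at a zero jump. -/
theorem rankineHugoniot_linearized {s : ℝ → ℝ} {Ul Ur : ℝ → State} {σ : ℝ} {U₀ Dl Dr : State}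
    (hs : Tendsto s (𝓝[>] 0) (𝓝 σ)) (hl : HasDerivWithinAt Ul Dl (Ioi 0) 0)
    (hr : HasDerivWithinAt Ur Dr (Ioi 0) 0) (hl0 : Ul 0 = U₀) (hr0 : Ur 0 = U₀)
    (h : ∀ᶠ t in 𝓝[>] 0, RankineHugoniot (s t) (Ul t) (Ur t)) :
    σ • (Dr - Dl) = fderiv ℝ flux U₀ (Dr - Dl) := by
  have hF : ∀ {w : ℝ → State} {w' : State}, HasDerivWithinAt w w' (Ioi 0) 0 → w 0 = U₀ →
      HasDerivWithinAt (fun t => flux (w t)) (fderiv ℝ flux U₀ w') (Ioi 0) 0 := by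
    intro w w' hw hw0
    have hd : HasFDerivAt flux (fderiv ℝ flux U₀) (w 0) := by
      rw [hw0]; exact (contDiff_flux.differentiable one_ne_zero U₀).hasFDerivAt
    exact hd.comp_hasDerivWithinAt 0 hw
  have h1 := tendsto_slope_zero_of_hasDerivWithinAt ((hF hr hr0).sub (hF hl hl0))
  -- The jump vanishes at t = 0, so convergence of the speed is enough; its derivative never enters.
  have h2 := hs.smul (tendsto_slope_zero_of_hasDerivWithinAt (hr.sub hl))
  rw [map_sub]
  refine tendsto_nhds_unique (h2.congr' ?_) h1
  filter_upwards [h] with t ht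
  have ht' : s t • (Ur t - Ul t) = flux (Ur t) - flux (Ul t) := ht
  simp only [Pi.sub_apply, hl0, hr0, sub_self, sub_zero]
  rw [smul_comm, ht']

/-! ### The Riemann problem with equal outer states -/

/-- The difference of the two cubics is a - c times a quadratic form that the sign conditions make
positive. Applied to u and to v, this recovers a state from its Rankine–Hugoniot invariants. -/
theorem eq_of_mul_sub_sq_eq {w a c : ℝ} (ha : w * a < 0) (hc : w * c < 0)
    (h : a * (w - a) ^ 2 = c * (w - c) ^ 2) : a = c := by
  have h1 : (a - c) * (w ^ 2 - 2 * (w * a) - 2 * (w * c) + (a ^ 2 + a * c + c ^ 2)) = 0 := by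
    linear_combination h
  have h2 : 0 < w ^ 2 - 2 * (w * a) - 2 * (w * c) + (a ^ 2 + a * c + c ^ 2) := by
    nlinarith [sq_nonneg (a + c), sq_nonneg a, sq_nonneg c, sq_nonneg w]
  rcases mul_eq_zero.1 h1 with h | h
  · linarith
  · exact absurd h h2.ne'

/-- In this form the f and b equations share one factor, as do the g and q equations. Multiplying
each pair gives a scalar cubic equation in u or in v. -/
theorem RankineHugoniot.eqs {σ : ℝ} {Ul Ur : State} (h : RankineHugoniot σ Ul Ur) :
    (Ur 0 * (2 * σ - u Ur) = Ul 0 * (2 * σ - u Ul) ∧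
      Ur 1 * (2 * σ - u Ur) = Ul 1 * (2 * σ - u Ul)) ∧
    Ur 2 * (2 * σ - 2 * u Ur - v Ur) = Ul 2 * (2 * σ - 2 * u Ul - v Ul) ∧
      Ur 3 * (2 * σ - 2 * u Ur - v Ur) = Ul 3 * (2 * σ - 2 * u Ul - v Ul) := by
  have h0 := congrFun h 0
  have h1 := congrFun h 1
  have h2 := congrFun h 2
  have h3 := congrFun h 3
  simp [flux] at h0 h1 h2 h3
  simp only [u, v]
  refine ⟨⟨?_, ?_⟩, ?_, ?_⟩ <;> linarith

theorem u_neg {U : State} (h : U ∈ stateSpace) : u U < 0 := mul_neg_of_pos_of_neg h.1 h.2.1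

theorem v_pos {U : State} (h : U ∈ stateSpace) : 0 < v U := mul_pos h.2.2.1 h.2.2.2.1

theorem u_add_v_nonneg {U : State} (h : U ∈ stateSpace) : 0 ≤ u U + v U := h.2.2.2.2

/-- Shocks of the fourth family do not change `f` and `b`. -/
theorem IsWave.fourth_eq {σ : ℝ} {Ul Ur : State} (hl : Ul ∈ stateSpace) (hr : Ur ∈ stateSpace)
    (h : IsWave 3 σ Ul Ur) : Ur 0 = Ul 0 ∧ Ur 1 = Ul 1 := by
  obtain ⟨hRH, h1, -⟩ := h
  obtain ⟨⟨e0, e1⟩, -⟩ := hRH.eqs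
  -- The Lax condition and u + v ≥ 0 give σ ≥ u + 3v/2 ≥ v/2 > 0.
  have hσ : 0 < 2 * σ := by
    have := v_pos hr
    have := u_add_v_nonneg hr
    unfold lambda4 at h1
    linarith
  have hul := u_neg hl
  have huu : u Ur = u Ul := by
    refine eq_of_mul_sub_sq_eq (mul_neg_of_pos_of_neg hσ (u_neg hr))
      (mul_neg_of_pos_of_neg hσ hul) ?_
    calc u Ur * (2 * σ - u Ur) ^ 2
        = (Ur 0 * (2 * σ - u Ur)) * (Ur 1 * (2 * σ - u Ur)) := by rw [u]; ring
      _ = u Ul * (2 * σ - u Ul) ^ 2 := by rw [e0, e1, u]; ring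
  rw [huu] at e0 e1
  have hne : 2 * σ - u Ul ≠ 0 := by linarith
  exact ⟨mul_right_cancel₀ hne e0, mul_right_cancel₀ hne e1⟩

/-- A wave of the first family that does not change `u` is trivial. -/
theorem IsWave.first_eq {σ : ℝ} {Ul Ur : State} (hl : Ul ∈ stateSpace) (hr : Ur ∈ stateSpace)
    (h : IsWave 0 σ Ul Ur) (huu : u Ur = u Ul) : Ur = Ul := by
  obtain ⟨hRH, h1, h2⟩ := h
  obtain ⟨⟨e0, e1⟩, e2, e3⟩ := hRH.eqs
  unfold lambda1 at h1 h2
  have hul := u_neg hl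
  -- With equal u on both sides, the two Lax inequalities pinch σ to λ₁.
  have hσ : 2 * σ = 3 * u Ul := by linarith
  rw [huu] at e0 e1 e2 e3
  have hne : 2 * σ - u Ul ≠ 0 := by linarith
  have hvv : v Ur = v Ul := by
    have hw : 2 * σ - 2 * u Ul < 0 := by linarith
    refine eq_of_mul_sub_sq_eq (mul_neg_of_neg_of_pos hw (v_pos hr))
      (mul_neg_of_neg_of_pos hw (v_pos hl)) ?_
    calc v Ur * (2 * σ - 2 * u Ul - v Ur) ^ 2
        = (Ur 2 * (2 * σ - 2 * u Ul - v Ur)) * (Ur 3 * (2 * σ - 2 * u Ul - v Ur)) := by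
          rw [v]; ring
      _ = v Ul * (2 * σ - 2 * u Ul - v Ul) ^ 2 := by rw [e2, e3, v]; ring
  rw [hvv] at e2 e3
  have hne' : 2 * σ - 2 * u Ul - v Ul ≠ 0 := by
    have := v_pos hl
    linarith
  ext i
  fin_cases i
  · exact mul_right_cancel₀ hne e0
  · exact mul_right_cancel₀ hne e1
  · exact mul_right_cancel₀ hne' e2
  · exact mul_right_cancel₀ hne' e3

/-- The Riemann problem with equal outer states has only the constant solution. -/
theorem riemann_const {W : Fin 5 → State} {σ : Fin 4 → ℝ} {U₀ : State}
    (hW : ∀ j, W j ∈ stateSpace)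
    (hw : ∀ i : Fin 4, IsWave i (σ i) (W i.castSucc) (W i.succ))
    (h0 : W 0 = U₀) (h4 : W 4 = U₀) :
    (∀ j, W j = U₀) ∧ σ 0 = 3 / 2 * u U₀ ∧ σ 1 = u U₀ / 2 ∧ σ 2 = u U₀ + v U₀ / 2 ∧
      σ 3 = u U₀ + 3 / 2 * v U₀ := by
  have hU₀ : U₀ ∈ stateSpace := h0 ▸ hW 0
  have w0 : IsWave 0 (σ 0) U₀ (W 1) := by rw [← h0]; exact hw 0
  have w1 : IsWave 1 (σ 1) (W 1) (W 2) := hw 1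
  have w2 : IsWave 2 (σ 2) (W 2) (W 3) := hw 2
  have w3 : IsWave 3 (σ 3) (W 3) U₀ := by rw [← h4]; exact hw 3
  obtain ⟨h34, h34'⟩ := w3.fourth_eq (hW 3) hU₀
  obtain ⟨s2, h23, h23', hv23⟩ := w2
  obtain ⟨s1, hu12, hg12, hq12⟩ := w1
  have hW1 : W 1 = U₀ := by
    -- Read from the right: fronts 4 and 3 preserve f and b, and front 2 preserves u. So front 1
    -- cannot change u.
    refine w0.first_eq hU₀ (hW 1) ?_
    rw [← hu12, u, u, ← h23, ← h23', h34, h34']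
  rw [hW1] at s1 hu12 hg12 hq12
  -- The components f, b are inherited from the right outer state, g, q from the left one.
  have hW2 : W 2 = U₀ := by
    ext i
    fin_cases i
    · exact h23.symm.trans h34.symm
    · exact h23'.symm.trans h34'.symm
    · exact hg12
    · exact hq12
  rw [hW2] at s2 h23 h23' hv23
  have hu3 : u (W 3) = u U₀ := by rw [u, u, h23, h23']
  obtain ⟨hRH, l1, l2⟩ := w3
  unfold lambda4 at l1 l2
  rw [hu3, hv23] at l2
  have s3 : σ 3 = u U₀ + 3 / 2 * v U₀ := le_antisymm l2 l1
  obtain ⟨-, e2, e3⟩ := hRH.eqs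
  rw [hu3, hv23] at e2 e3
  have hne : 2 * σ 3 - 2 * u U₀ - v U₀ ≠ 0 := by
    have := v_pos hU₀
    linarith
  have hW3 : W 3 = U₀ := by
    ext i
    fin_cases i
    · exact h23
    · exact h23'
    · exact (mul_right_cancel₀ hne e2).symm
    · exact (mul_right_cancel₀ hne e3).symm
  refine ⟨fun j => ?_, ?_, s1, s2, s3⟩
  · fin_cases j
    exacts [h0, hW1, hW2, hW3, h4]
  · rw [hW1] at w0
    exact le_antisymm w0.2.2 w0.2.1

/-! ### Linear algebra of the instantaneous derivatives -/

/-- The slopes of `u`, `ξ`, `τ` and the fourth Riemann invariant diagonalize the jump conditions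
for the derivatives. Here `P j` and `Q j` are the traces of `U_x` and `U_t` in the `j`-th region. -/
theorem acoustic_of_traces {U₀ : State} (hU₀ : U₀ ∈ stateSpace) {P Q : Fin 5 → State}
    (hpde : ∀ j, Q j + fderiv ℝ flux U₀ (P j) = 0) {D : Fin 4 → State} {σ : Fin 4 → ℝ}
    (hD : ∀ i : Fin 4, D i = (σ i • P i.succ + Q i.succ) - (σ i • P i.castSucc + Q i.castSucc))
    (s0 : σ 0 = 3 / 2 * u U₀) (s1 : σ 1 = u U₀ / 2) (s2 : σ 2 = u U₀ + v U₀ / 2)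
    (s3 : σ 3 = u U₀ + 3 / 2 * v U₀)
    (j0 : σ 0 • D 0 = fderiv ℝ flux U₀ (D 0))
    (j1 : uSlope U₀ (D 1) = 0 ∧ vSlope U₀ (D 1) = 0)
    (j2 : uSlope U₀ (D 2) = 0 ∧ vSlope U₀ (D 2) = 0)
    (j3 : σ 3 • D 3 = fderiv ℝ flux U₀ (D 3)) :
    (acousticMatrix U₀).mulVec ![Q 1 0, Q 1 1, Q 1 2, Q 1 3, Q 3 2, Q 3 3] =
      acousticRHS U₀ (P 0) (P 4) := by
  have hb : U₀ 1 ≠ 0 := hU₀.2.1.ne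
  have hq : U₀ 3 ≠ 0 := hU₀.2.2.2.1.ne'
  have hu := u_neg hU₀
  have hv := v_pos hU₀
  have huv := u_add_v_nonneg hU₀
  have hQ : ∀ j, Q j = (-1 : ℝ) • fderiv ℝ flux U₀ (P j) := fun j => by
    rw [neg_one_smul]; exact eq_neg_of_add_eq_zero_left (hpde j)
  have Qu : ∀ j, uSlope U₀ (Q j) = -(3 / 2 * u U₀ * uSlope U₀ (P j)) := fun j => by
    rw [hQ, uSlope_smul, uSlope_fderiv_flux]; ring
  have Qv : ∀ j, vSlope U₀ (Q j) = -((u U₀ + 3 / 2 * v U₀) * vSlope U₀ (P j)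
      + 2 * v U₀ * uSlope U₀ (P j)) := fun j => by
    rw [hQ, vSlope_smul, vSlope_fderiv_flux]; ring
  have Qx : ∀ j, xiSlope U₀ (Q j) = -(1 / 2 * u U₀ * xiSlope U₀ (P j)) := fun j => by
    rw [hQ, xiSlope_smul, xiSlope_fderiv_flux _ _ hb]; ring
  have Qt : ∀ j, tauSlope U₀ (Q j) = -((u U₀ + 1 / 2 * v U₀) * tauSlope U₀ (P j)) := fun j => by
    rw [hQ, tauSlope_smul, tauSlope_fderiv_flux _ _ hq]; ring
  -- By the conservation law `D i` is σ i - F'(U₀) applied to the jump of `P`; the next four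
  -- identities are its components.
  have Du : ∀ i : Fin 4, uSlope U₀ (D i) =
      (σ i - 3 / 2 * u U₀) * (uSlope U₀ (P i.succ) - uSlope U₀ (P i.castSucc)) := fun i => by
    rw [hD, uSlope_sub, uSlope_add, uSlope_add, uSlope_smul, uSlope_smul, Qu, Qu]; ring
  have Dx : ∀ i : Fin 4, xiSlope U₀ (D i) =
      (σ i - 1 / 2 * u U₀) * (xiSlope U₀ (P i.succ) - xiSlope U₀ (P i.castSucc)) := fun i => by
    rw [hD, xiSlope_sub, xiSlope_add, xiSlope_add, xiSlope_smul, xiSlope_smul, Qx, Qx]; ring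
  have Dt : ∀ i : Fin 4, tauSlope U₀ (D i) = (σ i - (u U₀ + 1 / 2 * v U₀)) *
      (tauSlope U₀ (P i.succ) - tauSlope U₀ (P i.castSucc)) := fun i => by
    rw [hD, tauSlope_sub, tauSlope_add, tauSlope_add, tauSlope_smul, tauSlope_smul, Qt, Qt]; ring
  have Dv : ∀ i : Fin 4, vSlope U₀ (D i) = (σ i - (u U₀ + 3 / 2 * v U₀)) *
      (vSlope U₀ (P i.succ) - vSlope U₀ (P i.castSucc))
      - 2 * v U₀ * (uSlope U₀ (P i.succ) - uSlope U₀ (P i.castSucc)) := fun i => by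
    rw [hD, vSlope_sub, vSlope_add, vSlope_add, vSlope_smul, vSlope_smul, Qv, Qv]; ring
  have d0x := congrArg (xiSlope U₀) j0
  have d0t := congrArg (tauSlope U₀) j0
  have d0v := congrArg (vSlope U₀) j0
  have d3u := congrArg (uSlope U₀) j3
  have d3t := congrArg (tauSlope U₀) j3
  rw [xiSlope_smul, xiSlope_fderiv_flux _ _ hb, Dx, s0] at d0x
  rw [tauSlope_smul, tauSlope_fderiv_flux _ _ hq, Dt, s0] at d0t
  rw [vSlope_smul, vSlope_fderiv_flux, Dv, Du, s0] at d0v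
  rw [uSlope_smul, uSlope_fderiv_flux, Du, s3] at d3u
  rw [tauSlope_smul, tauSlope_fderiv_flux _ _ hq, Dt, s3] at d3t
  obtain ⟨d1u, d1v⟩ := j1
  obtain ⟨d2u, d2v⟩ := j2
  rw [Du, s1] at d1u
  rw [Du, s2] at d2u
  rw [Dv, s1] at d1v
  rw [Dv, s2] at d2v
  simp only [show (0 : Fin 4).castSucc = 0 from rfl, show (0 : Fin 4).succ = 1 from rfl,
    show (1 : Fin 4).castSucc = 1 from rfl, show (1 : Fin 4).succ = 2 from rfl,
    show (2 : Fin 4).castSucc = 2 from rfl, show (2 : Fin 4).succ = 3 from rfl,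
    show (3 : Fin 4).castSucc = 3 from rfl, show (3 : Fin 4).succ = 4 from rfl]
    at d0x d0t d0v d1u d1v d2u d2v d3u d3t
  -- The factor σ - λ appears once through `D` and once through the linearized jump condition, hence
  -- the squares here and below.
  have x10 : xiSlope U₀ (P 1) = xiSlope U₀ (P 0) := by
    have : u U₀ ^ 2 * (xiSlope U₀ (P 1) - xiSlope U₀ (P 0)) = 0 := by linear_combination d0x
    have := (mul_eq_zero.1 this).resolve_left (pow_ne_zero 2 hu.ne)
    linarith
  have t10 : tauSlope U₀ (P 1) = tauSlope U₀ (P 0) := by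
    have : (u U₀ - v U₀) ^ 2 * (tauSlope U₀ (P 1) - tauSlope U₀ (P 0)) = 0 := by
      linear_combination 4 * d0t
    have := (mul_eq_zero.1 this).resolve_left (pow_ne_zero 2 (by linarith))
    linarith
  have t34 : tauSlope U₀ (P 3) = tauSlope U₀ (P 4) := by
    have : v U₀ ^ 2 * (tauSlope U₀ (P 4) - tauSlope U₀ (P 3)) = 0 := by linear_combination d3t
    have := (mul_eq_zero.1 this).resolve_left (by positivity)
    linarith
  have u34 : uSlope U₀ (P 3) = uSlope U₀ (P 4) := by
    have : (3 * v U₀ - u U₀) ^ 2 * (uSlope U₀ (P 4) - uSlope U₀ (P 3)) = 0 := by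
      linear_combination 4 * d3u
    have := (mul_eq_zero.1 this).resolve_left (pow_ne_zero 2 (by linarith))
    linarith
  have u23 : uSlope U₀ (P 2) = uSlope U₀ (P 3) := by
    have := (mul_eq_zero.1 d2u).resolve_left (by linarith)
    linarith
  have u12 : uSlope U₀ (P 1) = uSlope U₀ (P 2) := by
    have := (mul_eq_zero.1 d1u).resolve_left (by linarith)
    linarith
  rw [u12, sub_self, mul_zero, sub_zero] at d1v
  rw [u23, sub_self, mul_zero, sub_zero] at d2v
  -- The coefficient is -(u₀ + 3v₀)/2, nonzero because u₀ + v₀ ≥ 0 and v₀ > 0.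
  have v12 : vSlope U₀ (P 1) = vSlope U₀ (P 2) := by
    have := (mul_eq_zero.1 d1v).resolve_left (by linarith)
    linarith
  have v23 : vSlope U₀ (P 2) = vSlope U₀ (P 3) := by
    have := (mul_eq_zero.1 d2v).resolve_left (by linarith)
    linarith
  have hne : 3 * v U₀ - u U₀ ≠ 0 := by linarith
  -- At σ = λ₁ the u-component of `D 0` vanishes, so the v-component must vanish too: one factor λ₁
  -- - λ₄ cancels and the coupling to u' remains.
  have v01 : (3 * v U₀ - u U₀) * (vSlope U₀ (P 1) - vSlope U₀ (P 0)) +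
      4 * v U₀ * (uSlope U₀ (P 1) - uSlope U₀ (P 0)) = 0 := by
    have : (3 * v U₀ - u U₀) * ((3 * v U₀ - u U₀) * (vSlope U₀ (P 1) - vSlope U₀ (P 0)) +
      4 * v U₀ * (uSlope U₀ (P 1) - uSlope U₀ (P 0))) = 0 := by
      linear_combination 4 * d0v
    exact (mul_eq_zero.1 this).resolve_left hne
  have u14 : uSlope U₀ (P 1) = uSlope U₀ (P 4) := u12.trans (u23.trans u34)
  have Qv13 : vSlope U₀ (Q 3) = vSlope U₀ (Q 1) := by
    rw [Qv, Qv, v12, v23, u12, u23]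
  have row3 : vSlope U₀ (Q 1) = acousticRHS U₀ (P 0) (P 4) 2 := by
    have hv1 : vSlope U₀ (P 1) = vSlope U₀ (P 0) -
        4 * v U₀ * (uSlope U₀ (P 4) - uSlope U₀ (P 0)) / (3 * v U₀ - u U₀) := by
      rw [u14] at v01
      apply mul_left_cancel₀ hne
      rw [mul_sub, mul_div_cancel₀ _ hne]
      linear_combination v01
    rw [Qv, hv1, u14]
    simp only [acousticRHS, Matrix.cons_val]
    field_simp
    ring
  ext k
  fin_cases k
  · have := Qu 1
    simp [acousticMatrix, acousticRHS, Matrix.mulVec, dotProduct, Fin.sum_univ_six]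
    rw [u14] at this
    simp only [uSlope] at this ⊢
    linarith
  · have := Qx 1
    simp [acousticMatrix, acousticRHS, Matrix.mulVec, dotProduct, Fin.sum_univ_six]
    rw [x10] at this
    simp only [xiSlope] at this ⊢
    linear_combination this
  · rw [vSlope] at row3
    simp [acousticMatrix, Matrix.mulVec, dotProduct, Fin.sum_univ_six]
    exact row3
  · have := Qt 1
    simp [acousticMatrix, acousticRHS, Matrix.mulVec, dotProduct, Fin.sum_univ_six]
    rw [t10] at this
    simp only [tauSlope] at this ⊢
    linear_combination this
  · simp only [vSlope] at Qv13
    simp [acousticMatrix, acousticRHS, Matrix.mulVec, dotProduct, Fin.sum_univ_six]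
    linear_combination Qv13
  · have := Qt 3
    simp [acousticMatrix, acousticRHS, Matrix.mulVec, dotProduct, Fin.sum_univ_six]
    rw [t34] at this
    simp only [tauSlope] at this ⊢
    linear_combination this

/-- The matrix is block lower triangular. Its 2 × 2 diagonal blocks are the Jacobians of (product,
quotient), with determinants -2f/b and -2g/q. -/
theorem isUnit_acousticMatrix {U : State} (hU : U ∈ stateSpace) : IsUnit (acousticMatrix U) := by
  have hf : U 0 ≠ 0 := hU.1.ne'
  have hb : U 1 ≠ 0 := hU.2.1.ne
  have hg : U 2 ≠ 0 := hU.2.2.1.ne'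
  have hq : U 3 ≠ 0 := hU.2.2.2.1.ne'
  rw [← Matrix.mulVec_injective_iff_isUnit, ← Matrix.coe_mulVecLin, injective_iff_map_eq_zero]
  intro w hw
  have h : ∀ k, (acousticMatrix U).mulVec w k = 0 := fun k => congrFun hw k
  have h0 := h 0
  have h1 := h 1
  have h2 := h 2
  have h3 := h 3
  have h4 := h 4
  have h5 := h 5
  simp [acousticMatrix, Matrix.mulVec, dotProduct, Fin.sum_univ_six] at h0 h1 h2 h3 h4 h5
  have key : ∀ {x y r s : ℝ}, x ≠ 0 → y ≠ 0 → y * r + x * s = 0 →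
      y⁻¹ * r + -(x / y ^ 2 * s) = 0 → r = 0 ∧ s = 0 := by
    intro x y r s hx hy e1 e2
    have e2' : y * r - x * s = 0 := by
      field_simp at e2
      linear_combination e2
    have hr : y * r = 0 := by linarith
    have hs : x * s = 0 := by linarith
    exact ⟨(mul_eq_zero.1 hr).resolve_left hy, (mul_eq_zero.1 hs).resolve_left hx⟩
  obtain ⟨w0, w1⟩ := key hf hb h0 h1
  obtain ⟨w2, w3⟩ := key hg hq h2 h3
  rw [w2, w3] at h4
  obtain ⟨w4, w5⟩ := key hg hq (by linarith) h5
  ext k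
  fin_cases k
  exacts [w0, w1, w2, w3, w4, w5]

/-! ### Wave conditions at the origin. -/

theorem tendsto_clm_apply {α E F : Type*} [NormedAddCommGroup E] [NormedSpace ℝ E]
    [NormedAddCommGroup F] [NormedSpace ℝ F] {l : Filter α} {A : α → E →L[ℝ] F} {x : α → E}
    {A₀ : E →L[ℝ] F} {x₀ : E} (hA : Tendsto A l (𝓝 A₀)) (hx : Tendsto x l (𝓝 x₀)) :
    Tendsto (fun a => A a (x a)) l (𝓝 (A₀ x₀)) :=
  (isBoundedBilinearMap_apply.continuous.tendsto (A₀, x₀)).comp (hA.prodMk_nhds hx)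

theorem IsWave.of_tendsto {i : Fin 4} {s : ℝ → ℝ} {Ul Ur : ℝ → State} {σ : ℝ} {Wl Wr : State}
    (hs : Tendsto s (𝓝[>] 0) (𝓝 σ)) (hl : Tendsto Ul (𝓝[>] 0) (𝓝 Wl))
    (hr : Tendsto Ur (𝓝[>] 0) (𝓝 Wr)) (h : ∀ᶠ t in 𝓝[>] 0, IsWave i (s t) (Ul t) (Ur t)) :
    IsWave i σ Wl Wr :=
  (isClosed_isWave i).mem_of_tendsto (hs.prodMk_nhds (hl.prodMk_nhds hr)) h

/-- The second family linearized at a zero jump. -/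
theorem second_wave_linearized {s : ℝ → ℝ} {Ul Ur : ℝ → State} {U₀ Dl Dr : State}
    (hl : HasDerivWithinAt Ul Dl (Ioi 0) 0) (hr : HasDerivWithinAt Ur Dr (Ioi 0) 0)
    (hl0 : Ul 0 = U₀) (hr0 : Ur 0 = U₀)
    (h : ∀ᶠ t in 𝓝[>] 0, IsWave 1 (s t) (Ul t) (Ur t)) :
    uSlope U₀ (Dr - Dl) = 0 ∧ vSlope U₀ (Dr - Dl) = 0 := by
  have hu := hasDerivWithinAt_Ioi_unique (hasDerivWithinAt_u hr) (hasDerivWithinAt_u hl)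
    (h.mono fun t ht => ht.2.1)
  have hv := hasDerivWithinAt_Ioi_unique (hasDerivWithinAt_v hr) (hasDerivWithinAt_v hl)
    (h.mono fun t ht => by rw [v, v, ht.2.2.1, ht.2.2.2])
  rw [hl0, hr0] at hu hv
  rw [uSlope_sub, vSlope_sub, hu, hv]
  exact ⟨sub_self _, sub_self _⟩

/-- The third family linearized at a zero jump. -/
theorem third_wave_linearized {s : ℝ → ℝ} {Ul Ur : ℝ → State} {U₀ Dl Dr : State}
    (hl : HasDerivWithinAt Ul Dl (Ioi 0) 0) (hr : HasDerivWithinAt Ur Dr (Ioi 0) 0)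
    (hl0 : Ul 0 = U₀) (hr0 : Ur 0 = U₀)
    (h : ∀ᶠ t in 𝓝[>] 0, IsWave 2 (s t) (Ul t) (Ur t)) :
    uSlope U₀ (Dr - Dl) = 0 ∧ vSlope U₀ (Dr - Dl) = 0 := by
  have hu := hasDerivWithinAt_Ioi_unique (hasDerivWithinAt_u hr) (hasDerivWithinAt_u hl)
    (h.mono fun t ht => by rw [u, u, ht.2.1, ht.2.2.1])
  have hv := hasDerivWithinAt_Ioi_unique (hasDerivWithinAt_v hr) (hasDerivWithinAt_v hl)
    (h.mono fun t ht => ht.2.2.2)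
  rw [hl0, hr0] at hu hv
  rw [uSlope_sub, vSlope_sub, hu, hv]
  exact ⟨sub_self _, sub_self _⟩

/-- Restriction of a one-sided first order expansion to a curve. -/
theorem hasDerivWithinAt_extendFrom_comp {S : Set (ℝ × ℝ)} {U : ℝ × ℝ → State}
    {L : ℝ × ℝ →L[ℝ] State}
    (hE : HasFDerivWithinAt (extendFrom S U) L
      {p | p ∈ closure S ∧ ∃ y, Tendsto U (𝓝[S] p) (𝓝 y)} 0)
    {γ : ℝ → ℝ × ℝ} {w : ℝ × ℝ} {r : ℝ} (hr : 0 < r)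
    (hγ : HasDerivWithinAt γ w (Ioi 0) 0) (hγ0 : γ 0 = 0)
    (hmem : ∀ t ∈ Ioo 0 r, γ t ∈ closure S)
    (hlim : ∀ t ∈ Ioo 0 r, ∃ y, Tendsto U (𝓝[S] (γ t)) (𝓝 y)) :
    HasDerivWithinAt (fun t => extendFrom S U (γ t)) (L w) (Ioi 0) 0 := by
  rw [← hγ0] at hE
  have := hE.comp_hasDerivWithinAt (s := Ioo 0 r) 0 (hγ.mono Ioo_subset_Ioi_self)
    fun t ht => ⟨hmem t ht, hlim t ht⟩
  exact this.mono_of_mem_nhdsWithin (Ioo_mem_nhdsGT hr)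

/-! ### Topology of the regions between the fronts. -/

namespace IsGRPSolution

variable {PL PR : ℝ → State} {δ T : ℝ} {X : Fin 4 → ℝ → ℝ} {U : ℝ × ℝ → State}

theorem continuousAt_front (hU : IsGRPSolution PL PR δ T X U) (i : Fin 4) {t : ℝ}
    (ht : t ∈ Ioo 0 T) : ContinuousAt (X i) t :=
  (hU.front_contDiff i).continuousOn.continuousAt (Ico_mem_nhds ht.1 ht.2)

theorem hasDerivAt_front (hU : IsGRPSolution PL PR δ T X U) (i : Fin 4) {t : ℝ}
    (ht : t ∈ Ioo 0 T) : HasDerivAt (X i) (deriv (X i) t) t :=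
  (((hU.front_contDiff i).differentiableOn one_ne_zero).differentiableAt
    (Ico_mem_nhds ht.1 ht.2)).hasDerivAt

theorem tendsto_front (hU : IsGRPSolution PL PR δ T X U) (i : Fin 4) :
    Tendsto (X i) (𝓝[>] 0) (𝓝 0) := by
  have h := (hU.front_contDiff i).continuousOn 0 ⟨le_rfl, hU.T_pos⟩
  have h' : Tendsto (X i) (𝓝[Ico 0 T] 0) (𝓝 0) := by
    have := h.tendsto
    rwa [hU.front_zero] at this
  refine h'.mono_left ?_
  rw [← nhdsWithin_Ioo_eq_nhdsGT hU.T_pos]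
  exact nhdsWithin_mono _ Ioo_subset_Ico_self

theorem isOpen_sector (hU : IsGRPSolution PL PR δ T X U) (j : Fin 5) :
    IsOpen (sector δ T X j) := by
  rw [isOpen_iff_mem_nhds]
  rintro ⟨x, t⟩ ⟨ht, hx, hk⟩
  have h1 : ∀ᶠ p : ℝ × ℝ in 𝓝 (x, t), p.2 ∈ Ioo 0 T :=
    continuousAt_snd.eventually (isOpen_Ioo.mem_nhds ht)
  have h2 : ∀ᶠ p : ℝ × ℝ in 𝓝 (x, t), p.1 ∈ Ioo (-δ) δ :=
    continuousAt_fst.eventually (isOpen_Ioo.mem_nhds hx)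
  have h3 : ∀ᶠ p : ℝ × ℝ in 𝓝 (x, t), ∀ i : Fin 4,
      (i.castSucc < j → X i p.2 < p.1) ∧ (j ≤ i.castSucc → p.1 < X i p.2) := by
    rw [eventually_all]
    intro i
    have hX : ContinuousAt (fun p : ℝ × ℝ => X i p.2) (x, t) :=
      ContinuousAt.comp (f := Prod.snd) (hU.continuousAt_front i ht) continuousAt_snd
    rw [eventually_and]
    constructor
    · by_cases hj : i.castSucc < j
      · filter_upwards [hX.eventually_lt continuousAt_fst ((hk i).1 hj)] with p hp _ using hp
      · exact Eventually.of_forall fun p hp => absurd hp hj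
    · by_cases hj : j ≤ i.castSucc
      · filter_upwards [(continuousAt_fst (p := (x, t))).eventually_lt hX ((hk i).2 hj)]
          with p hp _ using hp
      · exact Eventually.of_forall fun p hp => absurd hp hj
  filter_upwards [h1, h2, h3] with p a b c using ⟨a, b, c⟩

theorem front_mem_closure_left (hU : IsGRPSolution PL PR δ T X U) (i : Fin 4) {t : ℝ}
    (ht : t ∈ Ioo 0 T) : (X i t, t) ∈ closure (sector δ T X i.castSucc) := by
  have hδ := hU.front_mem i t (Ioo_subset_Ico_self ht)
  have hlim : Tendsto (fun x => (x, t)) (𝓝[<] (X i t)) (𝓝 (X i t, t)) :=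
    ((continuous_id.prodMk continuous_const).tendsto (X i t)).mono_left nhdsWithin_le_nhds
  refine mem_closure_of_tendsto hlim ?_
  have h1 : ∀ᶠ x in 𝓝[<] (X i t), ∀ k : Fin 4, k < i → X k t < x := by
    rw [eventually_all]
    intro k
    by_cases hk : k < i
    · filter_upwards [nhdsWithin_le_nhds (lt_mem_nhds (hU.front_strictMono t ht hk))] with x hx _
        using hx
    · exact Eventually.of_forall fun p hp => absurd hp hk
  filter_upwards [self_mem_nhdsWithin, nhdsWithin_le_nhds (lt_mem_nhds hδ.1), h1] with x hx hx' hk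
  exact ⟨ht, ⟨hx', lt_trans hx hδ.2⟩, fun k => ⟨fun h => hk k h,
    fun h => lt_of_lt_of_le hx ((hU.front_strictMono t ht).monotone h)⟩⟩

theorem front_mem_closure_right (hU : IsGRPSolution PL PR δ T X U) (i : Fin 4) {t : ℝ}
    (ht : t ∈ Ioo 0 T) : (X i t, t) ∈ closure (sector δ T X i.succ) := by
  have hδ := hU.front_mem i t (Ioo_subset_Ico_self ht)
  have hlim : Tendsto (fun x => (x, t)) (𝓝[>] (X i t)) (𝓝 (X i t, t)) :=
    ((continuous_id.prodMk continuous_const).tendsto (X i t)).mono_left nhdsWithin_le_nhds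
  refine mem_closure_of_tendsto hlim ?_
  have h1 : ∀ᶠ x in 𝓝[>] (X i t), ∀ k : Fin 4, i < k → x < X k t := by
    rw [eventually_all]
    intro k
    by_cases hk : i < k
    · filter_upwards [nhdsWithin_le_nhds (gt_mem_nhds (hU.front_strictMono t ht hk))] with x hx _
        using hx
    · exact Eventually.of_forall fun p hp => absurd hp hk
  filter_upwards [self_mem_nhdsWithin, nhdsWithin_le_nhds (gt_mem_nhds hδ.2), h1] with x hx hx' hk
  exact ⟨ht, ⟨lt_trans hδ.1 hx, hx'⟩, fun k => ⟨fun h => lt_of_le_of_lt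
    ((hU.front_strictMono t ht).monotone (Fin.castSucc_lt_succ_iff.1 h)) hx,
    fun h => hk k (Fin.succ_le_castSucc_iff.1 h)⟩⟩

theorem zero_mem_closure_sector (hU : IsGRPSolution PL PR δ T X U) (j : Fin 5) :
    (0 : ℝ × ℝ) ∈ closure (sector δ T X j) := by
  have hlim : ∀ i, Tendsto (fun t => (X i t, t)) (𝓝[>] 0) (𝓝 (0 : ℝ × ℝ)) := fun i =>
    (hU.tendsto_front i).prodMk_nhds nhdsWithin_le_nhds
  -- The origin is reached along a bounding front, whose points lie only in the closure of the
  -- region.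
  rw [← closure_closure]
  have hT := Ioo_mem_nhdsGT hU.T_pos
  rcases Fin.eq_zero_or_eq_succ j with rfl | ⟨i, rfl⟩
  · refine mem_closure_of_tendsto (hlim 0) ?_
    filter_upwards [hT] with t ht using hU.front_mem_closure_left 0 ht
  · refine mem_closure_of_tendsto (hlim i) ?_
    filter_upwards [hT] with t ht using hU.front_mem_closure_right i ht

theorem left_mem_closure (hU : IsGRPSolution PL PR δ T X U) {x : ℝ} (hx : x ∈ Ioo (-δ) 0) :
    (x, 0) ∈ closure (sector δ T X 0) := by
  have hlim : Tendsto (fun t : ℝ => (x, t)) (𝓝[>] 0) (𝓝 (x, 0)) :=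
    tendsto_const_nhds.prodMk_nhds nhdsWithin_le_nhds
  refine mem_closure_of_tendsto hlim ?_
  have h1 : ∀ᶠ t in 𝓝[>] (0 : ℝ), ∀ i, x < X i t :=
    eventually_all.2 fun i => (hU.tendsto_front i).eventually (lt_mem_nhds hx.2)
  filter_upwards [h1, Ioo_mem_nhdsGT hU.T_pos] with t h ht
  exact ⟨ht, ⟨hx.1, hx.2.trans hU.δ_pos⟩, fun i => ⟨fun h => absurd h (Fin.not_lt_zero _),
    fun _ => h i⟩⟩

theorem right_mem_closure (hU : IsGRPSolution PL PR δ T X U) {x : ℝ} (hx : x ∈ Ioo 0 δ) :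
    (x, 0) ∈ closure (sector δ T X 4) := by
  have hlim : Tendsto (fun t : ℝ => (x, t)) (𝓝[>] 0) (𝓝 (x, 0)) :=
    tendsto_const_nhds.prodMk_nhds nhdsWithin_le_nhds
  refine mem_closure_of_tendsto hlim ?_
  have h1 : ∀ᶠ t in 𝓝[>] (0 : ℝ), ∀ i, X i t < x :=
    eventually_all.2 fun i => (hU.tendsto_front i).eventually (gt_mem_nhds hx.1)
  filter_upwards [h1, Ioo_mem_nhdsGT hU.T_pos] with t h ht
  exact ⟨ht, ⟨by linarith [hx.1, hU.δ_pos], hx.2⟩, fun i => ⟨fun _ => h i,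
    fun h => absurd h (not_le_of_gt (Fin.castSucc_lt_last i))⟩⟩

/-! ### Paths of controlled length to the origin. -/

theorem exists_front_bound (hU : IsGRPSolution PL PR δ T X U) :
    ∃ C, 1 ≤ C ∧ ∃ η, 0 < η ∧ η ≤ T ∧ ∀ t ∈ Ioo 0 η, ∀ i,
      |X i t| ≤ C * t ∧ |deriv (X i) t| ≤ C := by
  choose σ hσ hσ' using fun i => ContDiffOn.exists_tendsto_deriv_Ico hU.T_pos (hU.front_contDiff i)
  have hle : ∀ i, |σ i| < 1 + ∑ k, |σ k| := fun i => by
    have := Finset.single_le_sum (f := fun k => |σ k|) (fun k _ => abs_nonneg _)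
      (Finset.mem_univ i)
    linarith
  refine ⟨1 + ∑ k, |σ k|, le_add_of_nonneg_right (Finset.sum_nonneg fun k _ => abs_nonneg _), ?_⟩
  have h1 : ∀ᶠ t in 𝓝[>] (0 : ℝ), ∀ i, |X i t| ≤ (1 + ∑ k, |σ k|) * t ∧
      |deriv (X i) t| ≤ 1 + ∑ k, |σ k| := by
    rw [eventually_all]
    intro i
    have hs := (tendsto_slope_zero_of_hasDerivWithinAt (hσ' i)).abs
    filter_upwards [hs.eventually (gt_mem_nhds (hle i)),
      (hσ i).abs.eventually (gt_mem_nhds (hle i)), self_mem_nhdsWithin] with t a b ht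
    have ht : (0 : ℝ) < t := ht
    refine ⟨?_, b.le⟩
    rw [hU.front_zero, sub_zero, smul_eq_mul, abs_mul, abs_inv, abs_of_pos ht,
      inv_mul_lt_iff₀ ht] at a
    linarith
  obtain ⟨η, hη, h⟩ := mem_nhdsGT_iff_exists_Ioo_subset.1 h1
  refine ⟨min η T, lt_min hη hU.T_pos, min_le_right _ _, fun t ht => h ?_⟩
  exact ⟨ht.1, ht.2.trans_le (min_le_left _ _)⟩

/-- Every point of a region near the origin is joined to the origin by a path in the region whose
length is comparable to the distance. -/
def HasPaths (S : Set (ℝ × ℝ)) : Prop :=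
  ∃ C > 0, ∀ᶠ p in 𝓝[S] (0 : ℝ × ℝ), ∃ γ γ' : ℝ → ℝ × ℝ, ∃ t₀ > 0, γ t₀ = p ∧
    Tendsto γ (𝓝[>] 0) (𝓝 0) ∧ ∀ t ∈ Ioc 0 t₀, γ t ∈ S ∧ ‖γ t‖ ≤ C * ‖p‖ ∧
      HasDerivAt γ (γ' t) t ∧ t₀ * ‖γ' t‖ ≤ C * ‖p‖

/-- Paths are parametrized by time, as graphs t ↦ (c t, t). Requiring K‖p‖ < min δ η keeps them
inside the spatial window and within the times where the front bounds hold. -/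
theorem hasPaths_of_graphs (hU : IsGRPSolution PL PR δ T X U) {j : Fin 5} {η K : ℝ}
    (hη : 0 < η) (hK : 1 ≤ K)
    (h : ∀ p ∈ sector δ T X j, p.2 < η → ∃ c c' : ℝ → ℝ, c p.2 = p.1 ∧
      Tendsto c (𝓝[>] 0) (𝓝 0) ∧ ∀ t ∈ Ioc 0 p.2,
        (∀ i : Fin 4, (i.castSucc < j → X i t < c t) ∧ (j ≤ i.castSucc → c t < X i t)) ∧
        |c t| ≤ K * ‖p‖ ∧ HasDerivAt c (c' t) t ∧ p.2 * |c' t| ≤ K * ‖p‖) :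
    HasPaths (sector δ T X j) := by
  refine ⟨K, by linarith, ?_⟩
  have hn : Tendsto (fun p : ℝ × ℝ => K * ‖p‖) (𝓝[sector δ T X j] 0) (𝓝 (K * ‖(0 : ℝ × ℝ)‖)) :=
    ((continuous_const.mul continuous_norm).tendsto 0).mono_left nhdsWithin_le_nhds
  have hδη : K * ‖(0 : ℝ × ℝ)‖ < min δ η := by simpa using ⟨hU.δ_pos, hη⟩
  filter_upwards [self_mem_nhdsWithin, hn.eventually (gt_mem_nhds hδη)] with p hp hpK
  have hp2 : 0 < p.2 := hp.1.1
  have hpn : p.2 ≤ ‖p‖ := (le_abs_self _).trans (norm_snd_le p)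
  have hpn' : p.2 ≤ K * ‖p‖ := by nlinarith [norm_nonneg p]
  obtain ⟨c, c', hc, hc0, hct⟩ := h p hp (hpn'.trans_lt (hpK.trans_le (min_le_right _ _)))
  refine ⟨fun t => (c t, t), fun t => (c' t, 1), p.2, hp2, Prod.ext hc rfl,
    hc0.prodMk_nhds nhdsWithin_le_nhds, fun t ht => ?_⟩
  obtain ⟨hord, hcn, hcd, hcn'⟩ := hct t ht
  refine ⟨⟨⟨ht.1, ht.2.trans_lt hp.1.2⟩,
    abs_lt.1 (hcn.trans_lt (hpK.trans_le (min_le_left _ _))), hord⟩, ?_,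
    hcd.prodMk (hasDerivAt_id t), ?_⟩
  · rw [Prod.norm_def]
    refine max_le hcn ?_
    rw [Real.norm_eq_abs, abs_of_pos ht.1]
    exact ht.2.trans hpn'
  · rw [Prod.norm_def, mul_max_of_nonneg _ _ hp2.le]
    refine max_le hcn' ?_
    simpa using hpn'

/-- Regions between two fronts. -/
theorem hasPaths_between (hU : IsGRPSolution PL PR δ T X U) {j : Fin 5} {a b : Fin 4}
    (ha : a.castSucc < j) (hb : j ≤ b.castSucc) (hka : ∀ k : Fin 4, k.castSucc < j → k ≤ a)
    (hkb : ∀ k : Fin 4, j ≤ k.castSucc → b ≤ k) : HasPaths (sector δ T X j) := by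
  obtain ⟨C, hC, η, hη, hηT, hbd⟩ := hU.exists_front_bound
  refine hU.hasPaths_of_graphs hη hC fun p hp hpη => ?_
  have hpa : X a p.2 < p.1 := (hp.2.2 a).1 ha
  have hpb : p.1 < X b p.2 := (hp.2.2 b).2 hb
  have hp2 : 0 < p.2 := hp.1.1
  have hpn : p.2 ≤ ‖p‖ := (le_abs_self _).trans (norm_snd_le p)
  have hab : 0 < X b p.2 - X a p.2 := by linarith
  -- The path keeps the relative position s of p between the two fronts, so it never meets either of
  -- them for t > 0.
  set s := (p.1 - X a p.2) / (X b p.2 - X a p.2) with hs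
  have hs0 : 0 < s := div_pos (by linarith) hab
  have hs1 : s < 1 := (div_lt_one hab).2 (by linarith)
  have hsm : s * (X b p.2 - X a p.2) = p.1 - X a p.2 := div_mul_cancel₀ _ hab.ne'
  have hconv : ∀ {y z B : ℝ}, |y| ≤ B → |z| ≤ B → |(1 - s) * y + s * z| ≤ B := by
    intro y z B hy hz
    rw [abs_le] at hy hz ⊢
    constructor <;> nlinarith
  refine ⟨fun t => (1 - s) * X a t + s * X b t,
    fun t => (1 - s) * deriv (X a) t + s * deriv (X b) t, by linear_combination hsm, ?_,
    fun t ht => ?_⟩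
  · simpa using ((hU.tendsto_front a).const_mul (1 - s)).add ((hU.tendsto_front b).const_mul s)
  have htη : t ∈ Ioo 0 η := ⟨ht.1, ht.2.trans_lt hpη⟩
  have htT : t ∈ Ioo 0 T := ⟨ht.1, htη.2.trans_le hηT⟩
  have hmono := hU.front_strictMono t htT
  have hlt : X a t < X b t := hmono (Fin.castSucc_lt_castSucc_iff.1 (ha.trans_le hb))
  have hCt : C * t ≤ C * ‖p‖ := by
    have := ht.2.trans hpn
    gcongr
  refine ⟨fun k => ⟨fun hk => ?_, fun hk => ?_⟩,
    hconv ((hbd t htη a).1.trans hCt) ((hbd t htη b).1.trans hCt),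
    ((hU.hasDerivAt_front a htT).const_mul _).add ((hU.hasDerivAt_front b htT).const_mul _), ?_⟩
  · have : X k t ≤ X a t := hmono.monotone (hka k hk)
    nlinarith
  · have : X b t ≤ X k t := hmono.monotone (hkb k hk)
    nlinarith
  · have h1 := hconv (hbd t htη a).2 (hbd t htη b).2
    calc p.2 * |(1 - s) * deriv (X a) t + s * deriv (X b) t| ≤ ‖p‖ * C := by gcongr
      _ = C * ‖p‖ := mul_comm _ _

/-- Regions that lie on one side of all fronts. -/
theorem hasPaths_beside (hU : IsGRPSolution PL PR δ T X U) {j : Fin 5} {a : Fin 4}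
    (ha : ∀ p ∈ sector δ T X j, p.1 - X a p.2 ≠ 0)
    (hord : ∀ p ∈ sector δ T X j, ∀ t ∈ Ioo 0 T, ∀ y, 0 < (y - X a t) * (p.1 - X a p.2) →
      ∀ i : Fin 4, (i.castSucc < j → X i t < y) ∧ (j ≤ i.castSucc → y < X i t)) :
    HasPaths (sector δ T X j) := by
  obtain ⟨C, hC, η, hη, hηT, hbd⟩ := hU.exists_front_bound
  refine hU.hasPaths_of_graphs hη (K := 2 * C + 1) (by linarith) fun p hp hpη => ?_
  have hp2 : 0 < p.2 := hp.1.1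
  have hpn : p.2 ≤ ‖p‖ := (le_abs_self _).trans (norm_snd_le p)
  have hpn1 : |p.1| ≤ ‖p‖ := norm_fst_le p
  have hCp : C * p.2 ≤ C * ‖p‖ := by gcongr
  have hd : |p.1 - X a p.2| ≤ (C + 1) * ‖p‖ := by
    have := abs_sub p.1 (X a p.2)
    linarith [(hbd p.2 ⟨hp2, hpη⟩ a).1]
  -- The offset from the outermost front shrinks linearly and keeps its sign. Its rate is unbounded
  -- for p near the x-axis, but its product with the duration p.2 is not; this is why path speeds
  -- are bounded only after multiplication by `t₀`.
  refine ⟨fun t => X a t + t * ((p.1 - X a p.2) / p.2),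
    fun t => deriv (X a) t + 1 * ((p.1 - X a p.2) / p.2), by field_simp; ring, ?_, fun t ht => ?_⟩
  · have hid : Tendsto (fun t : ℝ => t) (𝓝[>] 0) (𝓝 0) := nhdsWithin_le_nhds
    simpa using (hU.tendsto_front a).add (hid.mul_const ((p.1 - X a p.2) / p.2))
  have htη : t ∈ Ioo 0 η := ⟨ht.1, ht.2.trans_lt hpη⟩
  have htT : t ∈ Ioo 0 T := ⟨ht.1, htη.2.trans_le hηT⟩
  have hCt : C * t ≤ C * ‖p‖ := by
    have := ht.2.trans hpn
    gcongr
  obtain ⟨hb1, hb2⟩ := hbd t htη a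
  refine ⟨hord p hp t htT _ ?_, ?_,
    (hU.hasDerivAt_front a htT).add ((hasDerivAt_id t).mul_const _), ?_⟩
  · have : (X a t + t * ((p.1 - X a p.2) / p.2) - X a t) * (p.1 - X a p.2) =
        t / p.2 * (p.1 - X a p.2) ^ 2 := by ring
    rw [this]
    have := ha p hp
    have := ht.1
    positivity
  · have h1 : |t * ((p.1 - X a p.2) / p.2)| ≤ |p.1 - X a p.2| := by
      rw [abs_mul, abs_div, abs_of_pos ht.1, abs_of_pos hp2, mul_div_assoc', div_le_iff₀ hp2,
        mul_comm]
      exact mul_le_mul_of_nonneg_left ht.2 (abs_nonneg _)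
    have := abs_add_le (X a t) (t * ((p.1 - X a p.2) / p.2))
    linarith
  · have h1 : p.2 * |(p.1 - X a p.2) / p.2| = |p.1 - X a p.2| := by
      rw [abs_div, abs_of_pos hp2, mul_div_cancel₀ _ hp2.ne']
    have h2 : p.2 * |deriv (X a) t| ≤ ‖p‖ * C := by gcongr
    have h3 := mul_le_mul_of_nonneg_left
      (abs_add_le (deriv (X a) t) (1 * ((p.1 - X a p.2) / p.2))) hp2.le
    rw [mul_add, one_mul, h1] at h3
    rw [one_mul]
    linarith

theorem hasPaths_sector (hU : IsGRPSolution PL PR δ T X U) (j : Fin 5) :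
    HasPaths (sector δ T X j) := by
  fin_cases j
  · have h0 : ∀ p ∈ sector δ T X 0, p.1 < X 0 p.2 := fun p hp => (hp.2.2 0).2 le_rfl
    refine hU.hasPaths_beside (a := 0) (fun p hp => (sub_neg.2 (h0 p hp)).ne)
      fun p hp t ht y hy i => ⟨fun h => absurd h (Fin.not_lt_zero _), fun _ => ?_⟩
    have hy' := neg_of_mul_pos_left hy (sub_neg.2 (h0 p hp)).le
    have : X 0 t ≤ X i t := (hU.front_strictMono t ht).monotone (Fin.zero_le i)
    linarith
  · exact hU.hasPaths_between (a := 0) (b := 1) (by decide) (by decide) (by decide) (by decide)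
  · exact hU.hasPaths_between (a := 1) (b := 2) (by decide) (by decide) (by decide) (by decide)
  · exact hU.hasPaths_between (a := 2) (b := 3) (by decide) (by decide) (by decide) (by decide)
  · have h0 : ∀ p ∈ sector δ T X 4, X 3 p.2 < p.1 := fun p hp => (hp.2.2 3).1 (by decide)
    refine hU.hasPaths_beside (a := 3) (fun p hp => (sub_pos.2 (h0 p hp)).ne')
      fun p hp t ht y hy i => ⟨fun _ => ?_,
        fun h => absurd h (not_le_of_gt (Fin.castSucc_lt_last i))⟩
    have hy' := pos_of_mul_pos_left hy (sub_pos.2 (h0 p hp)).le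
    have : X i t ≤ X 3 t := (hU.front_strictMono t ht).monotone (Fin.le_last i)
    linarith

/-! ### Expansion and conservation law at the origin. -/

theorem differentiableAt (hU : IsGRPSolution PL PR δ T X U) {j : Fin 5} {p : ℝ × ℝ}
    (hp : p ∈ sector δ T X j) : DifferentiableAt ℝ U p :=
  ((hU.contDiff j).differentiableOn one_ne_zero).differentiableAt
    ((hU.isOpen_sector j).mem_nhds hp)

/-- The conservation law for the traces at the origin. -/
theorem pde_trace (hU : IsGRPSolution PL PR δ T X U) {j : Fin 5} {W : State}
    {L : ℝ × ℝ →L[ℝ] State} (hW : Tendsto U (𝓝[sector δ T X j] 0) (𝓝 W))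
    (hL : Tendsto (fderiv ℝ U) (𝓝[sector δ T X j] 0) (𝓝 L)) :
    L (0, 1) + fderiv ℝ flux W (L (1, 0)) = 0 := by
  have : (𝓝[sector δ T X j] (0 : ℝ × ℝ)).NeBot :=
    mem_closure_iff_nhdsWithin_neBot.1 (hU.zero_mem_closure_sector j)
  have hF : Tendsto (fun p => fderiv ℝ flux (U p)) (𝓝[sector δ T X j] 0) (𝓝 (fderiv ℝ flux W)) :=
    ((contDiff_flux.continuous_fderiv one_ne_zero).tendsto W).comp hW
  have hlim := (tendsto_clm_apply hL (tendsto_const_nhds (x := ((0 : ℝ), (1 : ℝ))))).add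
    (tendsto_clm_apply hF (tendsto_clm_apply hL (tendsto_const_nhds (x := ((1 : ℝ), (0 : ℝ))))))
  refine tendsto_nhds_unique (hlim.congr' ?_) tendsto_const_nhds
  filter_upwards [self_mem_nhdsWithin] with p hp
  rw [← hU.pde j p hp]
  have hd : HasFDerivAt (fun r => flux (U r)) ((fderiv ℝ flux (U p)).comp (fderiv ℝ U p)) p :=
    ((contDiff_flux.differentiable one_ne_zero (U p)).hasFDerivAt).comp p
      (hU.differentiableAt hp).hasFDerivAt
  rw [hd.fderiv]
  rfl

theorem hasFDerivWithinAt_sector (hU : IsGRPSolution PL PR δ T X U) {j : Fin 5} {W : State}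
    {L : ℝ × ℝ →L[ℝ] State} (hW : Tendsto U (𝓝[sector δ T X j] 0) (𝓝 W))
    (hL : Tendsto (fderiv ℝ U) (𝓝[sector δ T X j] 0) (𝓝 L)) :
    HasFDerivWithinAt (extendFrom (sector δ T X j) U) L
      {p | p ∈ closure (sector δ T X j) ∧
        ∃ y, Tendsto U (𝓝[sector δ T X j] p) (𝓝 y)} 0 := by
  obtain ⟨C, hC, hpath⟩ := hU.hasPaths_sector j
  exact hasFDerivWithinAt_extendFrom (hU.zero_mem_closure_sector j) hW
    (isLittleO_of_tendsto_fderiv (fun p hp => hU.differentiableAt hp) hW hL hC hpath)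

end IsGRPSolution

end ThinFilm

/-! ### Assembly of the theorem. -/

open ThinFilm in
theorem mainTheorem3
    (U₀ UL' UR' : ThinFilm.State) (hU₀ : U₀ ∈ ThinFilm.stateSpace)
    (PL PR : ℝ → ThinFilm.State)
    (hPL : ContDiffOn ℝ 1 PL (Iic 0)) (hPR : ContDiffOn ℝ 1 PR (Ici 0))
    (hL : PL 0 = U₀) (hR : PR 0 = U₀)
    (hL' : derivWithin PL (Iic 0) 0 = UL') (hR' : derivWithin PR (Ici 0) 0 = UR')
    (hne : UL' ≠ UR')
    (δ T : ℝ) (X : Fin 4 → ℝ → ℝ) (U : ℝ × ℝ → ThinFilm.State)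
    (hU : ThinFilm.IsGRPSolution PL PR δ T X U)
    (dL dR : ThinFilm.State)
    (hdL : ThinFilm.IsInstantaneousTimeDeriv U (ThinFilm.sector δ T X 1) dL)
    (hdR : ThinFilm.IsInstantaneousTimeDeriv U (ThinFilm.sector δ T X 3) dR) :
    IsUnit (ThinFilm.acousticMatrix U₀) ∧
      (ThinFilm.acousticMatrix U₀).mulVec ![dL 0, dL 1, dL 2, dL 3, dR 2, dR 3] =
        ThinFilm.acousticRHS U₀ UL' UR' := by
  refine ⟨isUnit_acousticMatrix hU₀, ?_⟩
  choose W hWs hW using hU.trace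
  choose L hLt using hU.trace_fderiv
  choose σ hσ hσ' using fun i => ContDiffOn.exists_tendsto_deriv_Ico hU.T_pos (hU.front_contDiff i)
  -- The values of `U` on the fronts and on the x-axis are unconstrained; `extendFrom` replaces them
  -- by the traces from region j.
  have hE := fun j => hU.hasFDerivWithinAt_sector (hW j) (hLt j)
  have hE0 : ∀ j, extendFrom (sector δ T X j) U 0 = W j := fun j =>
    extendFrom_eq (hU.zero_mem_closure_sector j) (hW j)
  have hγ : ∀ i, HasDerivWithinAt (fun t => (X i t, t)) (σ i, 1) (Ioi 0) 0 := fun i =>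
    (hσ' i).prodMk (hasDerivWithinAt_id _ _)
  have hγ0 : ∀ i, ((X i 0, 0) : ℝ × ℝ) = 0 := fun i => by rw [hU.front_zero]; rfl
  have hl : ∀ i : Fin 4, HasDerivWithinAt
      (fun t => extendFrom (sector δ T X i.castSucc) U (X i t, t)) (L i.castSucc (σ i, 1))
      (Ioi 0) 0 := fun i =>
    hasDerivWithinAt_extendFrom_comp (hE i.castSucc) hU.T_pos (hγ i) (hγ0 i)
      (fun t ht => hU.front_mem_closure_left i ht) fun t ht => by
        obtain ⟨Ul, -, Ur, -, h, -⟩ := hU.wave i t ht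
        exact ⟨Ul, h⟩
  have hr : ∀ i : Fin 4, HasDerivWithinAt
      (fun t => extendFrom (sector δ T X i.succ) U (X i t, t)) (L i.succ (σ i, 1))
      (Ioi 0) 0 := fun i =>
    hasDerivWithinAt_extendFrom_comp (hE i.succ) hU.T_pos (hγ i) (hγ0 i)
      (fun t ht => hU.front_mem_closure_right i ht) fun t ht => by
        obtain ⟨Ul, -, Ur, -, -, h, -⟩ := hU.wave i t ht
        exact ⟨Ur, h⟩
  have hl0 : ∀ i : Fin 4, extendFrom (sector δ T X i.castSucc) U (X i 0, 0) = W i.castSucc :=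
    fun i => by rw [hγ0, hE0]
  have hr0 : ∀ i : Fin 4, extendFrom (sector δ T X i.succ) U (X i 0, 0) = W i.succ :=
    fun i => by rw [hγ0, hE0]
  have hwave : ∀ i : Fin 4, ∀ᶠ t in 𝓝[>] 0, IsWave i (deriv (X i) t)
      (extendFrom (sector δ T X i.castSucc) U (X i t, t))
      (extendFrom (sector δ T X i.succ) U (X i t, t)) := fun i => by
    filter_upwards [Ioo_mem_nhdsGT hU.T_pos] with t ht
    obtain ⟨Ul, -, Ur, -, h1, h2, h3⟩ := hU.wave i t ht
    rwa [extendFrom_eq (hU.front_mem_closure_left i ht) h1,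
      extendFrom_eq (hU.front_mem_closure_right i ht) h2]
  have hW0 : W 0 = U₀ ∧ L 0 (1, 0) = UL' := by
    -- The left data are read along t ↦ (-t, 0), so that all derivatives are taken from t > 0; the
    -- resulting sign cancels at the end.
    have hc : HasDerivWithinAt (fun t : ℝ => (-t, (0 : ℝ))) (-1, 0) (Ioi 0) 0 :=
      ((hasDerivWithinAt_id _ _).neg).prodMk (hasDerivWithinAt_const _ _ _)
    have hmem : ∀ t ∈ Ioo 0 δ, -t ∈ Ioo (-δ) 0 := fun t ht =>
      ⟨neg_lt_neg ht.2, neg_lt_zero.2 ht.1⟩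
    have h1 := hasDerivWithinAt_extendFrom_comp (hE 0) hU.δ_pos hc (by simp)
      (fun t ht => hU.left_mem_closure (hmem t ht))
      fun t ht => ⟨_, hU.initial_left _ (hmem t ht)⟩
    have hP : HasDerivWithinAt PL UL' (Iic 0) (-0) := by
      rw [← hL', neg_zero]
      exact (hPL.differentiableOn one_ne_zero 0 self_mem_Iic).hasDerivWithinAt
    have h2 : HasDerivWithinAt (fun t => PL (-t)) ((-1 : ℝ) • UL') (Ioi 0) 0 :=
      hP.scomp 0 (hasDerivWithinAt_id _ _).neg fun t ht => mem_Iic.2 (neg_lt_zero.2 ht).le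
    have heq : ∀ᶠ t in 𝓝[>] (0 : ℝ), extendFrom (sector δ T X 0) U (-t, 0) = PL (-t) := by
      filter_upwards [Ioo_mem_nhdsGT hU.δ_pos] with t ht
      exact extendFrom_eq (hU.left_mem_closure (hmem t ht)) (hU.initial_left _ (hmem t ht))
    constructor
    · have := tendsto_nhds_unique ((tendsto_zero_of_hasDerivWithinAt h1).congr' heq)
        (tendsto_zero_of_hasDerivWithinAt h2)
      simp only [neg_zero, hL] at this
      rw [← this, ← hE0]
      rfl
    · have := hasDerivWithinAt_Ioi_unique h1 h2 heq
      have hneg : ((-1 : ℝ), (0 : ℝ)) = (-1 : ℝ) • ((1 : ℝ), (0 : ℝ)) := by simp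
      rw [hneg, map_smul] at this
      exact smul_right_injective _ (by norm_num : (-1 : ℝ) ≠ 0) this
  have hW4 : W 4 = U₀ ∧ L 4 (1, 0) = UR' := by
    have hc : HasDerivWithinAt (fun t : ℝ => (t, (0 : ℝ))) (1, 0) (Ioi 0) 0 :=
      (hasDerivWithinAt_id _ _).prodMk (hasDerivWithinAt_const _ _ _)
    have h1 := hasDerivWithinAt_extendFrom_comp (hE 4) hU.δ_pos hc rfl
      (fun t ht => hU.right_mem_closure ht) fun t ht => ⟨_, hU.initial_right _ ht⟩
    have h2 : HasDerivWithinAt PR UR' (Ioi 0) 0 := by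
      rw [← hR']
      exact (hPR.differentiableOn one_ne_zero 0 self_mem_Ici).hasDerivWithinAt.mono
        Ioi_subset_Ici_self
    have heq : ∀ᶠ t in 𝓝[>] (0 : ℝ), extendFrom (sector δ T X 4) U (t, 0) = PR t := by
      filter_upwards [Ioo_mem_nhdsGT hU.δ_pos] with t ht
      exact extendFrom_eq (hU.right_mem_closure ht) (hU.initial_right _ ht)
    constructor
    · have := tendsto_nhds_unique ((tendsto_zero_of_hasDerivWithinAt h1).congr' heq)
        (tendsto_zero_of_hasDerivWithinAt h2)
      rw [hR] at this
      rw [← this, ← hE0]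
      rfl
    · exact hasDerivWithinAt_Ioi_unique h1 h2 heq
  have hwave0 : ∀ i : Fin 4, IsWave i (σ i) (W i.castSucc) (W i.succ) := fun i => by
    refine IsWave.of_tendsto (hσ i) ?_ ?_ (hwave i)
    · rw [← hl0]; exact tendsto_zero_of_hasDerivWithinAt (hl i)
    · rw [← hr0]; exact tendsto_zero_of_hasDerivWithinAt (hr i)
  obtain ⟨hWU, s0, s1, s2, s3⟩ := riemann_const hWs hwave0 hW0.1 hW4.1
  have hl0' := fun i => (hl0 i).trans (hWU _)
  have hr0' := fun i => (hr0 i).trans (hWU _)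
  have htime : ∀ {j : Fin 5} {d : State}, IsInstantaneousTimeDeriv U (sector δ T X j) d →
      L j (0, 1) = d := by
    intro j d hd
    have : (𝓝[sector δ T X j] ((0, 0) : ℝ × ℝ)).NeBot :=
      mem_closure_iff_nhdsWithin_neBot.1 (hU.zero_mem_closure_sector j)
    exact tendsto_nhds_unique (tendsto_clm_apply (hLt j) tendsto_const_nhds) hd
  have hsplit : ∀ (j : Fin 5) (s : ℝ), L j (s, 1) = s • L j (1, 0) + L j (0, 1) := fun j s => by
    rw [← map_smul, ← map_add]; simp
  -- All data become values of the limit derivatives `L j`, leaving pure linear algebra at U₀.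
  rw [← htime hdL, ← htime hdR, ← hW0.2, ← hW4.2]
  refine acoustic_of_traces hU₀ (P := fun j => L j (1, 0)) (Q := fun j => L j (0, 1)) (σ := σ)
    (D := fun i => L i.succ (σ i, 1) - L i.castSucc (σ i, 1)) (fun j => ?_) (fun i => ?_)
    s0 s1 s2 s3 ?_ ?_ ?_ ?_
  · rw [← hWU j]
    exact hU.pde_trace (hW j) (hLt j)
  · rw [hsplit i.succ (σ i), hsplit i.castSucc (σ i)]
  · exact rankineHugoniot_linearized (hσ 0) (hl 0) (hr 0) (hl0' 0) (hr0' 0)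
      ((hwave 0).mono fun t ht => ht.1)
  · exact second_wave_linearized (hl 1) (hr 1) (hl0' 1) (hr0' 1) (hwave 1)
  · exact third_wave_linearized (hl 2) (hr 2) (hl0' 2) (hr0' 2) (hwave 2)
  · exact rankineHugoniot_linearized (hσ 3) (hl 3) (hr 3) (hl0' 3) (hr0' 3)
      ((hwave 3).mono fun t ht => ht.1)
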